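/- **Setting.** Let $m\ge 1$, let $a_1,\dots,a_m\in\mathbb R^n$ be nonzero and $b_1,\dots,b_m\in\mathbb R$. Put $X_i=\{x:\langle a_i,x\rangle-b_i\le 0\}$, $X=\bigcap_{i=1}^m X_i$, $\alpha_{\min}=\min_i\|a_i\|$, $\alpha_{\max}=\max_i\|a_i\|$, and let $\Pi_X$ be the Euclidean projection on $X$. Assume that for some $\varepsilon>0$ there is $\bar x$ with $\langle a_i,\bar x\rangle-b_i\le-\varepsilon$ for all $i$. Let $\beta>0$ be a Hoffman constant of $a_1,\dots,a_m$: for all right-hand sides $b'\in\mathbb R^m$ whose system $\langle a_i,x\rangle\le b_i'$ $(i=1,\dots,m)$ is feasible, the distance of any $x\in\mathbb R^n$ to its solution set is at most $\beta$ times the sum of the distances of $x$ to the $m$ half-spaces. Let $f:\mathbb R^n\to\mathbb R$ be differentiable with $L_f$-Lipschitz gradient, $L_f>0$. For $\gamma,\delta>0$ let $$h_\delta(x;a,b)=\begin{cases}\frac{\langle a,x\rangle-b}{\|a\|},&\langle a,x\rangle-b>\delta,\\ \frac{(\langle a,x\rangle-b+\delta)^2}{4\delta\|a\|},&-\delta\le\langle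 a,x\rangle-b\le\delta,\\ 0,&\langle a,x\rangle-b<-\delta,\end{cases}\qquad F_{\gamma\delta}(x)=f(x)+\frac\gamma m\sum_{i=1}^m h_\delta(x;a_i,b_i),$$ and let $X^*_{\gamma\delta}$ be the set of minimizers of $F_{\gamma\delta}$ over $\mathbb R^n$. For $c>0$ let $R(c,\varepsilon)$ be a radius such that, for all $\gamma'>0$ and $0<\delta'\le\varepsilon$ with $\gamma'\delta'\le c$ and all $x\in X^*_{\gamma'\delta'}$, the ball of radius $R(c,\varepsilon)$ about the origin contains $\Pi_X[x]$ and, if $x\notin X$, every $z\in X$ with $h_{\delta'}(z;a_j,b_j)=0$ for all $j$ and $\|x-z\|\le\|x-\Pi_X[x]\|+\beta m\delta'/\alpha_{\min}$. Let $L(c,\varepsilon)=\max\{\|s\|: s\in\partial f(x),\ \|x\|\le R(c,\varepsilon)\}$. For $\kappa>0$ call $(\gamma,\delta)$ *$\kappa$-admissible* if $\gamma>0$ and $$0<\delta<\min\Big\{\varepsilon,\frac{16\alpha_{\min}^2}{\beta^2m^2}\Big\},\qquad \Gamma\le\gamma\le\frac{\kappa}{\delta},\qquad \Gamma=\max\Big\{L\Big(\frac1{m\beta}-\frac{\sqrt\delta}{4\alpha_{\min}}\Big)^{-1},\,4mL\alpha_{\max}\Big(\frac1{\sqrt\delta}+\frac{\beta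 m}{\alpha_{\min}}\Big)\Big\},$$ where $L=L(c,\varepsilon)$ for some $c>\kappa$ (and some radius $R(c,\varepsilon)$ as above). SAGA for the penalized problem with step size $\alpha>0$, started at $x^0\in\mathbb R^n$, puts $\phi_i^0=x^0$ for all $i$ and $G_i=\nabla f+\gamma\nabla h_\delta(\cdot;a_i,b_i)$; in step $t\ge0$ it picks $j_t$ uniformly from $\{1,\dots,m\}$, independently of the other picks, and sets $$x^{t+1}=x^t-\alpha\Big[G_{j_t}(x^t)-G_{j_t}(\phi^t_{j_t})+\frac1m\sum_{i=1}^mG_i(\phi_i^t)\Big],\qquad \phi^{t+1}_{j_t}=x^t,\qquad \phi_i^{t+1}=\phi_i^t\ (i\ne j_t).$$ **Theorem.** Let $\delta^0>0$. (a) Let $f$ be strongly convex with constant $\mu_f>0$, let $x^*$ be the minimizer of $f$ over $X$, let $(\gamma,\delta)$ be $2\mu_f\alpha_{\min}\delta^0$-admissible, and let $\alpha=\frac{1}{2(\mu_fm+L_f+\frac{\gamma\alpha_{\max}}{2\delta})}$. With $q_\gamma=1-\frac{\mu_f}{2(\mu_fm+L_f+\frac{\gamma\alpha_{\max}}{2\delta})}$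 there is a constant $C$ such that for all $t\ge 0$ $$\mathbb E\|x^t-\Pi_X[x^t]\|^2\le C\,q_\gamma^t,\qquad \mathbb E\|x^t-x^*\|^2\le C\,q_\gamma^t+2\delta^0 .$$ (b) Let $f$ be convex with bounded level sets, let $f^*=\min_Xf$, let $(\gamma,\delta)$ be $4\alpha_{\min}\delta^0$-admissible, and let $\alpha=\frac{1}{3(L_f+\frac{\gamma\alpha_{\max}}{2\delta})}$. Put $\bar x^t=\frac1t\sum_{k=1}^tx^k$. Then there is a constant $C$ such that for all $t\ge1$ $$\mathbb E[f(\bar x^t)]-f^*\le C\,\frac{4m}{t}+2\delta^0,$$ and for every $\tilde\varepsilon>0$ there is $T>0$ such that $-\gamma\tilde\varepsilon\le\mathbb E[f(\bar x^t)]-f^*$ for all $t>T$. -/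

import Mathlib

open MeasureTheory ProbabilityTheory

noncomputable section

namespace PenSAGA

/-- `ℝⁿ` with its Euclidean inner product and norm. -/
abbrev E (n : ℕ) : Type := EuclideanSpace ℝ (Fin n)

variable {n m : ℕ}

/-- The half-space `{x | ⟨a, x⟩ - b ≤ 0}`. -/
def halfSpace (a : E n) (b : ℝ) : Set (E n) := {x | inner ℝ a x - b ≤ 0}

/-- The feasible set `X`, the intersection of the half-spaces. -/
def feasible (a : Fin m → E n) (b : Fin m → ℝ) : Set (E n) := ⋂ i, halfSpace (a i) (b i)

/-- `α_min = min_j ‖a_j‖` (used only for `m ≥ 1`). -/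
def alphaMin (a : Fin m → E n) : ℝ := ⨅ j, ‖a j‖

/-- `α_max = max_j ‖a_j‖` (used only for `m ≥ 1`). -/
def alphaMax (a : Fin m → E n) : ℝ := ⨆ j, ‖a j‖

open Classical in
/-- A nearest point of `Y` to `x`; for a nonempty closed convex `Y` it exists and is unique, and
this is the Euclidean projection of `x` on `Y`. -/
def proj (Y : Set (E n)) (x : E n) : E n :=
  if h : ∃ p ∈ Y, ‖x - p‖ = Metric.infDist x Y then h.choose else x

/-- The one-sided Huber penalty `h_δ(x; a, b)`. -/
def penalty (δ : ℝ) (a : E n) (b : ℝ) (x : E n) : ℝ :=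
  if δ < inner ℝ a x - b then (inner ℝ a x - b) / ‖a‖
  else if -δ ≤ inner ℝ a x - b then (inner ℝ a x - b + δ) ^ 2 / (4 * δ * ‖a‖)
  else 0

/-- The penalized objective `F_{γδ}(x) = f(x) + (γ/m) ∑ h_δ(x; a_i, b_i)`. -/
def penObj (f : E n → ℝ) (a : Fin m → E n) (b : Fin m → ℝ) (γ δ : ℝ) (x : E n) : ℝ :=
  f x + γ / m * ∑ i, penalty δ (a i) (b i) x

/-- The solution set `X*_{γδ}` of the penalized problem. -/
def penSolutions (f : E n → ℝ) (a : Fin m → E n) (b : Fin m → ℝ) (γ δ : ℝ) : Set (E n) :=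
  {x | ∀ z, penObj f a b γ δ x ≤ penObj f a b γ δ z}

/-- `β = β(a_1, …, a_m) > 0` is a Hoffman constant: it depends on the normals only, so the error
bound holds for all right-hand sides for which the system is feasible. -/
def IsHoffmanConst (a : Fin m → E n) (β : ℝ) : Prop :=
  0 < β ∧ ∀ b : Fin m → ℝ, (feasible a b).Nonempty → ∀ x : E n,
    Metric.infDist x (feasible a b) ≤ β * ∑ i, Metric.infDist x (halfSpace (a i) (b i))

/-- The subdifferential of `f` at `x`. -/
def subdiff (f : E n → ℝ) (x : E n) : Set (E n) := {s | ∀ y, f x + inner ℝ s (y - x) ≤ f y}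

/-- `R` is a radius `R(c, ε)`: uniformly in `γ > 0`, `0 < δ ≤ ε` with `γ δ ≤ c`, the ball of radius
`R` about the origin contains the projections on `X` of the penalized solutions `x` and, for
infeasible `x`, all unpenalized feasible points `z` with
`‖x - z‖ ≤ ‖x - Π_X x‖ + β m δ / α_min`. -/
def IsRadius (f : E n → ℝ) (a : Fin m → E n) (b : Fin m → ℝ) (β ε c R : ℝ) : Prop :=
  ∀ γ δ : ℝ, 0 < γ → 0 < δ → δ ≤ ε → γ * δ ≤ c → ∀ x ∈ penSolutions f a b γ δ,
    ‖proj (feasible a b) x‖ ≤ R ∧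
    (x ∉ feasible a b → ∀ z ∈ feasible a b,
      (∀ j, penalty δ (a j) (b j) z = 0) →
      ‖x - z‖ ≤ ‖x - proj (feasible a b) x‖ + β * m * δ / alphaMin a → ‖z‖ ≤ R)

/-- `L = max {‖s‖ | s ∈ ∂f(x), ‖x‖ ≤ R}`. -/
def subgradBound (f : E n → ℝ) (R : ℝ) : ℝ :=
  sSup {r | ∃ x s : E n, ‖x‖ ≤ R ∧ s ∈ subdiff f x ∧ r = ‖s‖}

/-- The threshold `Γ` for the penalty weight. -/
def Gam (a : Fin m → E n) (β δ L : ℝ) : ℝ :=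
  max (L * (1 / (m * β) - √δ / (4 * alphaMin a))⁻¹)
    (4 * m * L * alphaMax a * (1 / √δ + β * m / alphaMin a))

/-- The admissible choices of `γ, δ` with `γ δ` bounded by `κ`:
`0 < δ < min {ε, 16 α_min² / (β² m²)}` and `Γ ≤ γ ≤ κ / δ`, where `Γ` is formed with
`L = L(c, ε)` for some `c > κ`. -/
def AdmissibleParams (f : E n → ℝ) (a : Fin m → E n) (b : Fin m → ℝ) (β ε κ γ δ : ℝ) : Prop :=
  0 < γ ∧ 0 < δ ∧ δ < min ε (16 * alphaMin a ^ 2 / (β ^ 2 * m ^ 2)) ∧ γ ≤ κ / δ ∧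
    ∃ c R : ℝ, κ < c ∧ IsRadius f a b β ε c R ∧ Gam a β δ (subgradBound f R) ≤ γ

/-- `f` is differentiable with `L`-Lipschitz gradient. -/
def HasLipschitzGradient (f : E n → ℝ) (L : ℝ) : Prop :=
  Differentiable ℝ f ∧ ∀ x y, ‖gradient f x - gradient f y‖ ≤ L * ‖x - y‖

/-- `∇f(x) + γ ∇h_δ(x; a_i, b_i)`, the gradient of the `i`-th component function. -/
def compGrad (f : E n → ℝ) (a : Fin m → E n) (b : Fin m → ℝ) (γ δ : ℝ) (i : Fin m) (x : E n) :
    E n :=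
  gradient f x + γ • gradient (penalty δ (a i) (b i)) x

/-- One SAGA step with component gradients `G` and step size `α` from the state `(x, φ)`, when the
index `j` is picked. -/
def sagaStep (G : Fin m → E n → E n) (α : ℝ) (s : E n × (Fin m → E n)) (j : Fin m) :
    E n × (Fin m → E n) :=
  (s.1 - α • (G j s.1 - G j (s.2 j) + (1 / (m : ℝ)) • ∑ i, G i (s.2 i)),
    Function.update s.2 j s.1)

/-- The state `(x^t, φ^t)` of SAGA when the picked indices are `j 0, j 1, …`, started at
`x^0 = φ_i^0 = x0`. -/
def sagaState (G : Fin m → E n → E n) (α : ℝ) (x0 : E n) (j : ℕ → Fin m) :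
    ℕ → E n × (Fin m → E n)
  | 0 => (x0, fun _ => x0)
  | t + 1 => sagaStep G α (sagaState G α x0 j t) (j t)

/-- The iterate `x^t` of SAGA applied to the penalized problem. -/
def iter (f : E n → ℝ) (a : Fin m → E n) (b : Fin m → ℝ) (γ δ α : ℝ) (x0 : E n)
    (j : ℕ → Fin m) (t : ℕ) : E n :=
  (sagaState (compGrad f a b γ δ) α x0 j t).1

/-- The average `(1/t) ∑_{k=1}^t x^k` of the iterates. -/
def avgIter (f : E n → ℝ) (a : Fin m → E n) (b : Fin m → ℝ) (γ δ α : ℝ) (x0 : E n)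
    (j : ℕ → Fin m) (t : ℕ) : E n :=
  (1 / (t : ℝ)) • ∑ k ∈ Finset.Icc 1 t, iter f a b γ δ α x0 j k

/-- The random indices `J 0, J 1, …` are independent and uniform on `{1, …, m}`. -/
structure IsUniformSampling {Ω : Type*} [MeasurableSpace Ω] (P : Measure Ω)
    (J : ℕ → Ω → Fin m) : Prop where
  measurable : ∀ t, Measurable (J t)
  indep : iIndepFun J P
  uniform : ∀ t i, P.real (J t ⁻¹' {i}) = 1 / m

end PenSAGA

end

namespace PenSAGA

section QuadBounds

variable {V : Type*} [NormedAddCommGroup V] [InnerProductSpace ℝ V]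

/-- `G` is a field of slopes of `g` for which `g` lies above its tangent paraboloids with curvature
`μ` and below those with curvature `L`. For a gradient field this says that `g` is `μ`-strongly
convex and `L`-smooth. -/
structure QuadBounds (g : V → ℝ) (G : V → V) (μ L : ℝ) : Prop where
  lower : ∀ x y, g x + inner ℝ (G x) (y - x) + μ / 2 * ‖y - x‖ ^ 2 ≤ g y
  upper : ∀ x y, g y ≤ g x + inner ℝ (G x) (y - x) + L / 2 * ‖y - x‖ ^ 2

namespace QuadBounds

variable {g h : V → ℝ} {G H : V → V} {μ ν L M : ℝ}

theorem mono (hg : QuadBounds g G μ L) (hμ : ν ≤ μ) (hL : L ≤ M) : QuadBounds g G ν M where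
  lower x y := le_trans (by gcongr) (hg.lower x y)
  upper x y := le_trans (hg.upper x y) (by gcongr)

theorem add (hg : QuadBounds g G μ L) (hh : QuadBounds h H ν M) :
    QuadBounds (fun x => g x + h x) (fun x => G x + H x) (μ + ν) (L + M) where
  lower x y := by
    have h1 := hg.lower x y
    have h2 := hh.lower x y
    rw [inner_add_left]
    linarith
  upper x y := by
    have h1 := hg.upper x y
    have h2 := hh.upper x y
    rw [inner_add_left]
    linarith

theorem const_mul (hg : QuadBounds g G μ L) {c : ℝ} (hc : 0 ≤ c) :
    QuadBounds (fun x => c * g x) (fun x => c • G x) (c * μ) (c * L) where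
  lower x y := by
    have h1 := mul_le_mul_of_nonneg_left (hg.lower x y) hc
    rw [real_inner_smul_left]
    linarith
  upper x y := by
    have h1 := mul_le_mul_of_nonneg_left (hg.upper x y) hc
    rw [real_inner_smul_left]
    linarith

/-- The average of finitely many functions with common curvature bounds has these bounds. -/
theorem average {m : ℕ} (hm : 0 < m) {g : Fin m → V → ℝ} {G : Fin m → V → V}
    (hg : ∀ i, QuadBounds (g i) (G i) μ L) :
    QuadBounds (fun x => (1 / (m : ℝ)) * ∑ i, g i x) (fun x => (1 / (m : ℝ)) • ∑ i, G i x)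
      μ L where
  lower x y := by
    have hm' : (0 : ℝ) < m := by exact_mod_cast hm
    have h := Finset.sum_le_sum fun i (_ : i ∈ Finset.univ) => (hg i).lower x y
    simp only [Finset.sum_add_distrib, ← sum_inner, Finset.sum_const, Finset.card_univ,
      Fintype.card_fin, nsmul_eq_mul] at h
    have h' := mul_le_mul_of_nonneg_left h (by positivity : 0 ≤ 1 / (m : ℝ))
    rw [real_inner_smul_left]
    refine le_trans (le_of_eq ?_) h'
    field_simp
  upper x y := by
    have hm' : (0 : ℝ) < m := by exact_mod_cast hm
    have h := Finset.sum_le_sum fun i (_ : i ∈ Finset.univ) => (hg i).upper x y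
    simp only [Finset.sum_add_distrib, ← sum_inner, Finset.sum_const, Finset.card_univ,
      Fintype.card_fin, nsmul_eq_mul] at h
    have h' := mul_le_mul_of_nonneg_left h (by positivity : 0 ≤ 1 / (m : ℝ))
    rw [real_inner_smul_left]
    refine le_trans h' (le_of_eq ?_)
    field_simp

theorem abs_sub_le (hg : QuadBounds g G 0 L) (x y : V) :
    |g y - g x - inner ℝ (G x) (y - x)| ≤ L / 2 * ‖y - x‖ ^ 2 := by
  have h1 := hg.lower x y
  have h2 := hg.upper x y
  rw [abs_le]
  constructor <;> linarith

theorem hasGradientAt [CompleteSpace V] (hg : QuadBounds g G 0 L) (x : V) :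
    HasGradientAt g (G x) x := by
  rw [hasGradientAt_iff_isLittleO]
  have h1 : (fun y => g y - g x - inner ℝ (G x) (y - x)) =O[nhds x] fun y => ‖y - x‖ ^ 2 :=
    Asymptotics.IsBigO.of_bound (L / 2) (Filter.Eventually.of_forall fun y => by
      simpa [abs_of_nonneg] using hg.abs_sub_le x y)
  refine h1.trans_isLittleO ?_
  have h2 : Filter.Tendsto (fun y => y - x) (nhds x) (nhds 0) := by
    have : Continuous fun y : V => y - x := by fun_prop
    simpa using this.tendsto x
  exact (Asymptotics.isLittleO_norm_pow_id one_lt_two).comp_tendsto h2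

theorem monotone_slope (hg : QuadBounds g G μ L) (x y : V) :
    μ * ‖x - y‖ ^ 2 ≤ inner ℝ (G x - G y) (x - y) := by
  have h1 := hg.lower x y
  have h2 := hg.lower y x
  have h3 : inner ℝ (G x) (y - x) = - inner ℝ (G x) (x - y) := by
    rw [← inner_neg_right, neg_sub]
  rw [norm_sub_rev y x, h3] at h1
  rw [inner_sub_left]
  linarith

/-- A slope field vanishes at a minimizer. -/
theorem slope_eq_zero (hg : QuadBounds g G μ L) (hL : 0 < L) {x : V} (hx : ∀ y, g x ≤ g y) :
    G x = 0 := by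
  have h1 := hg.upper x (x - (1 / L) • G x)
  have h2 := hx (x - (1 / L) • G x)
  have h3 : x - (1 / L) • G x - x = -((1 / L) • G x) := by abel
  rw [h3, inner_neg_right, real_inner_smul_right, real_inner_self_eq_norm_sq, norm_neg, norm_smul,
    mul_pow, Real.norm_eq_abs, sq_abs] at h1
  have h4 : L / 2 * ((1 / L) ^ 2 * ‖G x‖ ^ 2) = 1 / L * ‖G x‖ ^ 2 / 2 := by field_simp
  have h5 : 1 / L * ‖G x‖ ^ 2 ≤ 0 := by linarith
  have h6 : ‖G x‖ ^ 2 ≤ 0 := nonpos_of_mul_nonpos_right h5 (by positivity)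
  simpa using h6

/-- The gap to the value at another point is dominated by the squared slope. -/
theorem two_mul_gap_le (hg : QuadBounds g G μ L) (hμ : 0 ≤ μ) (x y : V) :
    2 * μ * (g x - g y) ≤ ‖G x‖ ^ 2 := by
  have h1 := mul_le_mul_of_nonneg_left (hg.lower x y) hμ
  have h2 : 0 ≤ ‖G x + μ • (y - x)‖ ^ 2 := by positivity
  rw [norm_add_sq_real, real_inner_smul_right, norm_smul, mul_pow, Real.norm_eq_abs, sq_abs] at h2
  nlinarith

theorem norm_sub_sub_smul_sq_le (hg : QuadBounds g G μ L) (hL : μ < L) (x y : V) :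
    ‖G x - G y - μ • (x - y)‖ ^ 2 ≤
      2 * (L - μ) * (g y - g x - inner ℝ (G x) (y - x) - μ / 2 * ‖y - x‖ ^ 2) := by
  have hK : 0 < L - μ := sub_pos.2 hL
  have hKne := hK.ne'
  set D := G x - G y - μ • (x - y) with hD
  set s := (1 / (L - μ)) with hs
  have h1 := hg.lower x (y + s • D)
  have h2 := hg.upper y (y + s • D)
  have e1 : y + s • D - x = (y - x) + s • D := by abel
  have e2 : y + s • D - y = s • D := by abel
  have hG : G y = G x - μ • (x - y) - D := by rw [hD]; abel
  rw [e1, norm_add_sq_real, inner_add_right] at h1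
  rw [e2, hG] at h2
  simp only [real_inner_smul_right, inner_sub_left, real_inner_smul_left, norm_smul, mul_pow,
    Real.norm_eq_abs, sq_abs, real_inner_self_eq_norm_sq] at h1 h2
  have h3 : s * ‖D‖ ^ 2 - (L - μ) / 2 * (s ^ 2 * ‖D‖ ^ 2) ≤
      g y - g x - inner ℝ (G x) (y - x) - μ / 2 * ‖y - x‖ ^ 2 := by linarith
  have h4 : s * ‖D‖ ^ 2 - (L - μ) / 2 * (s ^ 2 * ‖D‖ ^ 2) = ‖D‖ ^ 2 / (2 * (L - μ)) := by
    rw [hs]; field_simp; ring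
  rw [h4, div_le_iff₀ (by positivity)] at h3
  linarith

/-- The interpolation inequality for strongly convex smooth functions. -/
theorem interpolation (hg : QuadBounds g G μ L) (hL : μ < L) (hL0 : 0 < L) (x y : V) :
    (L - μ) / L * (g x - g y) + 1 / (2 * L) * ‖G x - G y‖ ^ 2 + μ / 2 * ‖x - y‖ ^ 2 ≤
      inner ℝ (G x) (x - y) - μ / L * inner ℝ (G y) (x - y) := by
  have h := hg.norm_sub_sub_smul_sq_le hL x y
  have e : inner ℝ (G x) (y - x) = - inner ℝ (G x) (x - y) := by
    rw [← inner_neg_right, neg_sub]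
  rw [e, norm_sub_rev y x, norm_sub_sq_real, real_inner_smul_right, norm_smul, mul_pow,
    Real.norm_eq_abs, sq_abs, inner_sub_left] at h
  have hK : 0 < L - μ := sub_pos.2 hL
  have h' : 0 ≤ (inner ℝ (G x) (x - y) - μ / L * inner ℝ (G y) (x - y) -
      ((L - μ) / L * (g x - g y) + 1 / (2 * L) * ‖G x - G y‖ ^ 2 + μ / 2 * ‖x - y‖ ^ 2))
      * (2 * L) := by
    field_simp
    linarith
  have := nonneg_of_mul_nonneg_left h' (by positivity)
  linarith

theorem norm_sub_sq_le (hg : QuadBounds g G μ L) (hμ : 0 ≤ μ) (hL : 0 < L) (x y : V) :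
    ‖G x - G y‖ ^ 2 ≤ 2 * L * (g x - g y - inner ℝ (G y) (x - y)) := by
  have h := (hg.mono hμ le_rfl).norm_sub_sub_smul_sq_le hL y x
  simpa [norm_sub_rev (G y) (G x)] using h

end QuadBounds

end QuadBounds

section Variance

variable {V : Type*} [NormedAddCommGroup V] [InnerProductSpace ℝ V]

theorem norm_sub_sq_le_of_pos {β : ℝ} (hβ : 0 < β) (p q : V) :
    ‖p - q‖ ^ 2 ≤ (1 + β) * ‖p‖ ^ 2 + (1 + 1 / β) * ‖q‖ ^ 2 := by
  have h : 0 ≤ (1 / β) * ‖β • p + q‖ ^ 2 := by positivity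
  rw [norm_add_sq_real, real_inner_smul_left, norm_smul, mul_pow, Real.norm_eq_abs, sq_abs] at h
  have e : (1 / β) * (β ^ 2 * ‖p‖ ^ 2 + 2 * (β * inner ℝ p q) + ‖q‖ ^ 2) =
      β * ‖p‖ ^ 2 + 2 * inner ℝ p q + 1 / β * ‖q‖ ^ 2 := by field_simp
  rw [e] at h
  rw [norm_sub_sq_real]
  linarith

theorem sum_inner_average {m : ℕ} (hm : 0 < m) (z : V) (u : Fin m → V) :
    ∑ j, inner ℝ z (u j) = m * inner ℝ z ((1 / (m : ℝ)) • ∑ i, u i) := by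
  have hm' : (m : ℝ) ≠ 0 := by exact_mod_cast hm.ne'
  rw [← inner_sum, real_inner_smul_right]
  field_simp

/-- Bound for the second moment of a variance-reduced estimator. -/
theorem average_norm_sq_le {m : ℕ} (hm : 0 < m) {β : ℝ} (hβ : 0 < β) (u w : Fin m → V) :
    (1 / (m : ℝ)) * ∑ j, ‖u j - w j + (1 / (m : ℝ)) • ∑ i, w i‖ ^ 2 ≤
      (1 + 1 / β) * ((1 / (m : ℝ)) * ∑ j, ‖w j‖ ^ 2) +
        (1 + β) * ((1 / (m : ℝ)) * ∑ j, ‖u j‖ ^ 2) - β * ‖(1 / (m : ℝ)) • ∑ i, u i‖ ^ 2 := by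
  have hm' : (0 : ℝ) < m := by exact_mod_cast hm
  have hU := sum_inner_average hm ((1 / (m : ℝ)) • ∑ i, u i) u
  have hUW := sum_inner_average hm ((1 / (m : ℝ)) • ∑ i, u i) w
  have hW := sum_inner_average hm ((1 / (m : ℝ)) • ∑ i, w i) w
  set U := (1 / (m : ℝ)) • ∑ i, u i
  set W := (1 / (m : ℝ)) • ∑ i, w i
  have key : ∀ j, ‖u j - w j + W‖ ^ 2 ≤
      (1 + 1 / β) * ‖w j‖ ^ 2 + (1 + β) * ‖u j‖ ^ 2 + (β * ‖U‖ ^ 2 + 2 * inner ℝ U W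
        + (1 + 1 / β) * ‖W‖ ^ 2) - 2 * β * inner ℝ U (u j) - 2 * inner ℝ U (w j)
        - 2 * (1 + 1 / β) * inner ℝ W (w j) := by
    intro j
    have h1 := norm_sub_sq_le_of_pos hβ (u j - U) (w j - W)
    have e1 : u j - w j + W = U + ((u j - U) - (w j - W)) := by abel
    rw [e1, norm_add_sq_real]
    simp only [inner_sub_right, real_inner_self_eq_norm_sq]
    rw [norm_sub_sq_real (u j), norm_sub_sq_real (w j), real_inner_comm U, real_inner_comm W] at h1
    linarith
  have hsum := Finset.sum_le_sum fun j (_ : j ∈ Finset.univ) => key j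
  simp only [Finset.sum_add_distrib, Finset.sum_sub_distrib, ← Finset.mul_sum, Finset.sum_const,
    Finset.card_univ, Fintype.card_fin, nsmul_eq_mul, hU, hUW, hW, real_inner_self_eq_norm_sq]
    at hsum
  have h2 := mul_le_mul_of_nonneg_left hsum (by positivity : 0 ≤ 1 / (m : ℝ))
  have hd : 0 ≤ (1 + 1 / β) * ‖W‖ ^ 2 := by positivity
  refine h2.trans (le_trans (le_of_eq ?_) (sub_le_self _ hd))
  field_simp
  ring

end Variance

section Step

variable {n m : ℕ}

/-- The Bregman distance of `y` from `z` for the slope field `G` of `g`. -/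
noncomputable def bregman (g : E n → ℝ) (G : E n → E n) (z y : E n) : ℝ :=
  g y - g z - inner ℝ (G z) (y - z)

/-- The average Bregman distance of the stored points from `z`. -/
noncomputable def tableGap (g : Fin m → E n → ℝ) (G : Fin m → E n → E n) (z : E n)
    (φ : Fin m → E n) : ℝ :=
  (1 / (m : ℝ)) * ∑ i, bregman (g i) (G i) z (φ i)

theorem tableGap_nonneg {g : Fin m → E n → ℝ} {G : Fin m → E n → E n} {μ L : ℝ}
    (hg : ∀ i, QuadBounds (g i) (G i) μ L) (hμ : 0 ≤ μ) (z : E n) (φ : Fin m → E n) :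
    0 ≤ tableGap g G z φ := by
  refine mul_nonneg (by positivity) (Finset.sum_nonneg fun i _ => ?_)
  have := ((hg i).mono hμ le_rfl).lower z (φ i)
  simp only [bregman]
  linarith

theorem average_bregman {g : Fin m → E n → ℝ} {G : Fin m → E n → E n} {z : E n}
    (hz : ∑ i, G i z = 0) (x : E n) :
    (1 / (m : ℝ)) * ∑ i, bregman (g i) (G i) z x =
      (1 / (m : ℝ)) * ∑ i, g i x - (1 / (m : ℝ)) * ∑ i, g i z := by
  simp only [bregman, Finset.sum_sub_distrib, ← sum_inner, hz, inner_zero_left]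
  ring

/-- The expected table gap after one step. -/
theorem average_tableGap_update (hm : 0 < m) {g : Fin m → E n → ℝ} {G : Fin m → E n → E n}
    {z : E n} (hz : ∑ i, G i z = 0) (x : E n) (φ : Fin m → E n) :
    (1 / (m : ℝ)) * ∑ j, tableGap g G z (Function.update φ j x) =
      (1 - 1 / m) * tableGap g G z φ +
        1 / m * ((1 / (m : ℝ)) * ∑ i, g i x - (1 / (m : ℝ)) * ∑ i, g i z) := by
  have hm' : (m : ℝ) ≠ 0 := by exact_mod_cast hm.ne'
  rw [← average_bregman hz]
  have h1 : ∀ j, ∑ i, bregman (g i) (G i) z (Function.update φ j x i) =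
      ∑ i, bregman (g i) (G i) z (φ i) +
        (bregman (g j) (G j) z x - bregman (g j) (G j) z (φ j)) := by
    intro j
    rw [← Finset.add_sum_erase _ _ (Finset.mem_univ j),
      ← Finset.add_sum_erase _ (fun i => bregman (g i) (G i) z (φ i)) (Finset.mem_univ j),
      Finset.sum_congr rfl fun i hi => by rw [Function.update_of_ne (Finset.ne_of_mem_erase hi)]]
    simp only [Function.update_self]
    ring
  simp only [tableGap, ← Finset.mul_sum, h1, Finset.sum_add_distrib, Finset.sum_sub_distrib,
    Finset.sum_const, Finset.card_univ, Fintype.card_fin, nsmul_eq_mul]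
  field_simp
  ring

/-- The expected squared distance to the minimizer after one step. -/
theorem average_norm_sq_sagaStep_le (hm : 0 < m) {g : Fin m → E n → ℝ} {G : Fin m → E n → E n}
    {μ L α β : ℝ} (hg : ∀ i, QuadBounds (g i) (G i) μ L) (hμ : 0 ≤ μ) (hL : μ < L) (hα : 0 < α)
    (hβ : 0 < β) {z : E n} (hz : ∑ i, G i z = 0) (s : E n × (Fin m → E n)) :
    (1 / (m : ℝ)) * ∑ j, ‖(sagaStep G α s j).1 - z‖ ^ 2 ≤
      (1 - α * μ) * ‖s.1 - z‖ ^ 2 +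
        ((1 + β) * α ^ 2 - α / L) * ((1 / (m : ℝ)) * ∑ j, ‖G j s.1 - G j z‖ ^ 2) -
        2 * α * ((L - μ) / L + α * β * μ) *
          ((1 / (m : ℝ)) * ∑ i, g i s.1 - (1 / (m : ℝ)) * ∑ i, g i z) +
        2 * (1 + 1 / β) * α ^ 2 * L * tableGap g G z s.2 := by
  obtain ⟨x, φ⟩ := s
  have hm' : (0 : ℝ) < m := by exact_mod_cast hm
  have hL0 : 0 < L := hμ.trans_lt hL
  have hvar := average_norm_sq_le hm hβ (fun j => G j x - G j z) (fun j => G j (φ j) - G j z)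
  simp only [Finset.sum_sub_distrib, hz, sub_zero, sub_sub_sub_cancel_right] at hvar
  -- the stored slopes
  have htab : (1 / (m : ℝ)) * ∑ j, ‖G j (φ j) - G j z‖ ^ 2 ≤ 2 * L * tableGap g G z φ := by
    rw [tableGap, ← mul_assoc, mul_comm (2 * L), mul_assoc]
    refine mul_le_mul_of_nonneg_left ?_ (by positivity)
    rw [Finset.mul_sum]
    exact Finset.sum_le_sum fun j _ => (hg j).norm_sub_sq_le hμ hL0 (φ j) z
  -- the interpolation inequality, averaged
  have hint : (L - μ) / L * ((1 / (m : ℝ)) * ∑ i, g i x - (1 / (m : ℝ)) * ∑ i, g i z) +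
      1 / (2 * L) * ((1 / (m : ℝ)) * ∑ j, ‖G j x - G j z‖ ^ 2) + μ / 2 * ‖x - z‖ ^ 2 ≤
      inner ℝ ((1 / (m : ℝ)) • ∑ i, G i x) (x - z) := by
    have h := Finset.sum_le_sum fun i (_ : i ∈ Finset.univ) => (hg i).interpolation hL hL0 x z
    simp only [Finset.sum_add_distrib, Finset.sum_sub_distrib, ← Finset.mul_sum, ← sum_inner, hz,
      inner_zero_left, Finset.sum_const, Finset.card_univ, Fintype.card_fin, nsmul_eq_mul,
      mul_zero, sub_zero] at h
    have h2 := mul_le_mul_of_nonneg_left h (by positivity : 0 ≤ 1 / (m : ℝ))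
    rw [real_inner_smul_left]
    refine le_trans (le_of_eq ?_) h2
    field_simp
  have hgap := (QuadBounds.average hm hg).two_mul_gap_le hμ x z
  -- expansion of the step
  have hexp : (1 / (m : ℝ)) * ∑ j, ‖(sagaStep G α (x, φ) j).1 - z‖ ^ 2 =
      ‖x - z‖ ^ 2 - 2 * α * inner ℝ ((1 / (m : ℝ)) • ∑ i, G i x) (x - z) +
        α ^ 2 * ((1 / (m : ℝ)) *
          ∑ j, ‖G j x - G j (φ j) + (1 / (m : ℝ)) • ∑ i, G i (φ i)‖ ^ 2) := by
    have h1 : ∀ j, ‖(sagaStep G α (x, φ) j).1 - z‖ ^ 2 = ‖x - z‖ ^ 2 -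
        2 * α * inner ℝ (x - z) (G j x - G j (φ j) + (1 / (m : ℝ)) • ∑ i, G i (φ i)) +
        α ^ 2 * ‖G j x - G j (φ j) + (1 / (m : ℝ)) • ∑ i, G i (φ i)‖ ^ 2 := by
      intro j
      simp only [sagaStep]
      rw [sub_right_comm, norm_sub_sq_real, real_inner_smul_right, norm_smul, mul_pow,
        Real.norm_eq_abs, sq_abs]
      ring
    have h2 : ∑ j, inner ℝ (x - z) (G j x - G j (φ j) + (1 / (m : ℝ)) • ∑ i, G i (φ i)) =
        m * inner ℝ ((1 / (m : ℝ)) • ∑ i, G i x) (x - z) := by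
      rw [← inner_sum, Finset.sum_add_distrib, Finset.sum_sub_distrib, Finset.sum_const,
        Finset.card_univ, Fintype.card_fin, ← Nat.cast_smul_eq_nsmul ℝ, smul_smul,
        mul_one_div_cancel hm'.ne', one_smul, sub_add_cancel, real_inner_smul_left,
        real_inner_comm]
      field_simp
    simp only [h1, Finset.sum_add_distrib, Finset.sum_sub_distrib, ← Finset.mul_sum, h2,
      Finset.sum_const, Finset.card_univ, Fintype.card_fin, nsmul_eq_mul]
    field_simp
  rw [hexp]
  simp only
  set I := inner ℝ ((1 / (m : ℝ)) • ∑ i, G i x) (x - z)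
  set S := (1 / (m : ℝ)) * ∑ j, ‖G j x - G j (φ j) + (1 / (m : ℝ)) • ∑ i, G i (φ i)‖ ^ 2
  set A := (1 / (m : ℝ)) * ∑ j, ‖G j x - G j z‖ ^ 2
  set B := (1 / (m : ℝ)) * ∑ j, ‖G j (φ j) - G j z‖ ^ 2
  set Q := (1 / (m : ℝ)) * ∑ i, g i x - (1 / (m : ℝ)) * ∑ i, g i z
  have k1 := mul_le_mul_of_nonneg_left hvar (sq_nonneg α)
  have k2 := mul_le_mul_of_nonneg_left htab (by positivity : 0 ≤ α ^ 2 * (1 + 1 / β))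
  have k3 := mul_le_mul_of_nonneg_left hint (by positivity : 0 ≤ 2 * α)
  have k4 := mul_le_mul_of_nonneg_left hgap (by positivity : 0 ≤ α ^ 2 * β)
  have e : 2 * α * (1 / (2 * L) * A) = α / L * A := by field_simp
  linarith

/-- The Lyapunov function of SAGA. -/
noncomputable def lyapunov (g : Fin m → E n → ℝ) (G : Fin m → E n → E n) (z : E n) (c : ℝ)
    (s : E n × (Fin m → E n)) : ℝ :=
  tableGap g G z s.2 + c * ‖s.1 - z‖ ^ 2

theorem average_lyapunov_sagaStep_le (hm : 0 < m) {g : Fin m → E n → ℝ} {G : Fin m → E n → E n}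
    {μ L α β c : ℝ} (hg : ∀ i, QuadBounds (g i) (G i) μ L) (hμ : 0 ≤ μ) (hL : μ < L) (hα : 0 < α)
    (hβ : 0 < β) (hc : 0 ≤ c) {z : E n} (hz : ∑ i, G i z = 0) (s : E n × (Fin m → E n)) :
    (1 / (m : ℝ)) * ∑ j, lyapunov g G z c (sagaStep G α s j) ≤
      c * (1 - α * μ) * ‖s.1 - z‖ ^ 2 +
        c * α * ((1 + β) * α - 1 / L) * ((1 / (m : ℝ)) * ∑ j, ‖G j s.1 - G j z‖ ^ 2) +
        (1 / m - 2 * c * α * ((L - μ) / L + α * β * μ)) *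
          ((1 / (m : ℝ)) * ∑ i, g i s.1 - (1 / (m : ℝ)) * ∑ i, g i z) +
        (1 - 1 / m + 2 * c * (1 + 1 / β) * α ^ 2 * L) * tableGap g G z s.2 := by
  have h1 := mul_le_mul_of_nonneg_left (average_norm_sq_sagaStep_le hm hg hμ hL hα hβ hz s) hc
  have h2 := average_tableGap_update hm (g := g) hz s.1 s.2
  have h3 : (1 / (m : ℝ)) * ∑ j, lyapunov g G z c (sagaStep G α s j) =
      (1 / (m : ℝ)) * ∑ j, tableGap g G z (Function.update s.2 j s.1) +
        c * ((1 / (m : ℝ)) * ∑ j, ‖(sagaStep G α s j).1 - z‖ ^ 2) := by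
    simp only [lyapunov, Finset.sum_add_distrib, ← Finset.mul_sum]
    simp only [sagaStep]
    ring
  rw [h3, h2]
  refine le_trans (add_le_add_right h1 _) (le_of_eq ?_)
  ring

/-- Contraction of the Lyapunov function for strongly convex components. -/
theorem average_lyapunov_le_of_strong (hm : 0 < m) {g : Fin m → E n → ℝ}
    {G : Fin m → E n → E n} {μ L α : ℝ} (hg : ∀ i, QuadBounds (g i) (G i) μ L) (hμ : 0 < μ)
    (hL : μ < L) (hα : α = 1 / (2 * (μ * m + L))) {z : E n} (hz : ∑ i, G i z = 0)
    (s : E n × (Fin m → E n)) :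
    (1 / (m : ℝ)) * ∑ j, lyapunov g G z (1 / (2 * α * (1 - α * μ) * m)) (sagaStep G α s j) ≤
      (1 - α * μ) * lyapunov g G z (1 / (2 * α * (1 - α * μ) * m)) s := by
  have hm' : (1 : ℝ) ≤ m := by exact_mod_cast hm
  have hL0 : 0 < L := hμ.trans hL
  have hs : 0 < μ * m := by positivity
  have hα0 : 0 < α := by rw [hα]; positivity
  have hαμ : α * μ * (2 * (μ * m + L)) = μ := by rw [hα]; field_simp
  have hq : 0 < 1 - α * μ := by
    have : α * μ < 1 := by
      rw [hα, div_mul_eq_mul_div, one_mul, div_lt_one (by positivity)]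
      nlinarith
    linarith
  set c := 1 / (2 * α * (1 - α * μ) * m) with hc
  have hc0 : 0 ≤ c := by positivity
  have h := average_lyapunov_sagaStep_le hm hg hμ.le hL hα0
    (by positivity : 0 < (2 * μ * m + L) / L) hc0 hz s
  have e1 : (1 + (2 * μ * m + L) / L) * α - 1 / L = 0 := by rw [hα]; field_simp; ring
  have e2 : 1 / (m : ℝ) - 2 * c * α * ((L - μ) / L + α * ((2 * μ * m + L) / L) * μ) = 0 := by
    have : (L - μ) / L + α * ((2 * μ * m + L) / L) * μ = 1 - α * μ := by
      rw [hα]; field_simp; ring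
    rw [this, hc]
    field_simp
    simp
  have e3 : 1 - 1 / (m : ℝ) + 2 * c * (1 + 1 / ((2 * μ * m + L) / L)) * α ^ 2 * L ≤ 1 - α * μ := by
    have : 2 * c * (1 + 1 / ((2 * μ * m + L) / L)) * α ^ 2 * L =
        L / ((2 * μ * m + L) * (1 - α * μ) * m) := by
      have h1 : (1 + 1 / ((2 * μ * m + L) / L)) * α = 1 / (2 * μ * m + L) := by
        rw [hα]; field_simp; ring
      calc 2 * c * (1 + 1 / ((2 * μ * m + L) / L)) * α ^ 2 * L
          = 2 * c * ((1 + 1 / ((2 * μ * m + L) / L)) * α) * α * L := by ring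
        _ = _ := by rw [h1, hc]; field_simp
    rw [this]
    have h2 : α * μ + L / ((2 * μ * m + L) * (1 - α * μ) * m) ≤ 1 / m := by
      have hden : 1 - α * μ = (2 * μ * m + 2 * L - μ) / (2 * (μ * m + L)) := by
        rw [hα]; field_simp
      have hpos : 0 < 2 * μ * m + 2 * L - μ := by nlinarith
      have hle : μ * m + 2 * L ≤ 2 * μ * m + 2 * L - μ := by nlinarith
      have h3 : L / ((2 * μ * m + L) * (1 - α * μ) * m) ≤
          L * (2 * (μ * m + L)) / ((2 * μ * m + L) * (μ * m + 2 * L) * m) := by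
        rw [hden]
        have : L / ((2 * μ * m + L) * ((2 * μ * m + 2 * L - μ) / (2 * (μ * m + L))) * m) =
            L * (2 * (μ * m + L)) / ((2 * μ * m + L) * (2 * μ * m + 2 * L - μ) * m) := by
          field_simp
        rw [this]
        gcongr
      refine le_trans (add_le_add_right h3 _) ?_
      rw [hα, one_div_mul_eq_div, div_add_div _ _ (by positivity) (by positivity),
        div_le_div_iff₀ (by positivity) (by positivity)]
      have : 0 ≤ m * (2 * (μ * m) ^ 3 + 5 * (μ * m) ^ 2 * L + 4 * (μ * m) * L ^ 2) := by
        positivity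
      nlinarith
    linarith
  rw [e1, e2] at h
  have h0 := mul_le_mul_of_nonneg_right e3 (tableGap_nonneg hg hμ.le z s.2)
  refine h.trans ?_
  simp only [lyapunov]
  linarith

/-- Decrease of the Lyapunov function for convex components. -/
theorem average_lyapunov_le_of_convex (hm : 0 < m) {g : Fin m → E n → ℝ}
    {G : Fin m → E n → E n} {L α : ℝ} (hg : ∀ i, QuadBounds (g i) (G i) 0 L)
    (hL : 0 < L) (hα : α = 1 / (3 * L)) {z : E n} (hz : ∑ i, G i z = 0)
    (s : E n × (Fin m → E n)) :
    (1 / (m : ℝ)) * ∑ j, lyapunov g G z (1 / (α * m)) (sagaStep G α s j) ≤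
      lyapunov g G z (1 / (α * m)) s -
        1 / m * ((1 / (m : ℝ)) * ∑ i, g i s.1 - (1 / (m : ℝ)) * ∑ i, g i z) := by
  have hm' : (0 : ℝ) < m := by exact_mod_cast hm
  have hα0 : 0 < α := by rw [hα]; positivity
  have h := average_lyapunov_sagaStep_le hm hg le_rfl hL hα0 two_pos
    (by positivity : 0 ≤ 1 / (α * m)) hz s
  have e1 : (1 + 2) * α - 1 / L = 0 := by rw [hα]; field_simp; ring
  have e2 : 1 / (m : ℝ) - 2 * (1 / (α * m)) * α * ((L - 0) / L + α * 2 * 0) = - (1 / m) := by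
    field_simp
    ring
  have e3 : 1 - 1 / (m : ℝ) + 2 * (1 / (α * m)) * (1 + 1 / 2) * α ^ 2 * L = 1 := by
    rw [hα]; field_simp; ring
  rw [e1, e2, e3] at h
  refine h.trans (le_of_eq ?_)
  simp only [lyapunov]
  ring

end Step

section Sampling

variable {n m : ℕ} {Ω : Type*} [MeasurableSpace Ω] {P : Measure Ω} {J : ℕ → Ω → Fin m}

/-- `Ψ` depends on the first `t` terms of a sequence only. -/
def DependsOnPrefix (t : ℕ) (Ψ : (ℕ → Fin m) → ℝ) : Prop :=
  ∀ j j' : ℕ → Fin m, (∀ k < t, j k = j' k) → Ψ j = Ψ j'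

theorem DependsOnPrefix.exists_factor (hm : 0 < m) {t : ℕ} {Ψ : (ℕ → Fin m) → ℝ}
    (hΨ : DependsOnPrefix t Ψ) :
    ∃ Φ : (Finset.range t → Fin m) → ℝ, ∀ j, Ψ j = Φ fun k => j k := by
  refine ⟨fun p => Ψ fun k => if h : k ∈ Finset.range t then p ⟨k, h⟩ else ⟨0, hm⟩,
    fun j => hΨ _ _ fun k hk => ?_⟩
  rw [dif_pos (Finset.mem_range.2 hk)]

theorem DependsOnPrefix.integrable [IsProbabilityMeasure P] (hJ : IsUniformSampling P J)
    (hm : 0 < m) {t : ℕ} {Ψ : (ℕ → Fin m) → ℝ} (hΨ : DependsOnPrefix t Ψ) :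
    Integrable (fun ω => Ψ fun k => J k ω) P := by
  obtain ⟨Φ, hΦ⟩ := hΨ.exists_factor hm
  have hX : Measurable fun ω (k : Finset.range t) => J k ω :=
    measurable_pi_lambda _ fun k => hJ.measurable k
  have hfin : IsFiniteMeasure (P.map fun ω (k : Finset.range t) => J k ω) :=
    Measure.isFiniteMeasure_map P _
  have h : Integrable Φ (P.map fun ω (k : Finset.range t) => J k ω) := .of_finite
  simp only [hΦ]
  exact h.comp_measurable hX

/-- The expectation over a fresh uniform index is the average over all indices. -/
theorem integral_fresh_index [IsProbabilityMeasure P] (hJ : IsUniformSampling P J) (hm : 0 < m)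
    {t : ℕ} {Ψ : Fin m → (ℕ → Fin m) → ℝ} (hΨ : ∀ i, DependsOnPrefix t (Ψ i)) :
    ∫ ω, Ψ (J t ω) (fun k => J k ω) ∂P =
      ∫ ω, (1 / (m : ℝ)) * ∑ i, Ψ i (fun k => J k ω) ∂P := by
  classical
  choose Φ hΦ using fun i => (hΨ i).exists_factor hm
  have hX : Measurable fun ω (k : Finset.range t) => J k ω :=
    measurable_pi_lambda _ fun k => hJ.measurable k
  have hind : IndepFun (fun ω (k : Finset.range t) => J k ω) (J t) P := by
    have h := hJ.indep.indepFun_finset (Finset.range t) {t} (by simp) hJ.measurable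
    exact h.comp (φ := id) (ψ := fun p : ({t} : Finset ℕ) → Fin m => p ⟨t, by simp⟩)
      measurable_id (measurable_pi_apply _)
  have hsplit : ∀ ω, Ψ (J t ω) (fun k => J k ω) =
      ∑ i, Φ i (fun k => J k ω) * (({i} : Set (Fin m)).indicator (fun _ => (1 : ℝ)) (J t ω)) := by
    intro ω
    rw [Finset.sum_eq_single (J t ω)]
    · simp [hΦ]
    · intro i _ hi
      simp [Set.indicator, hi.symm]
    · simp
  have hone : ∀ i, ∫ ω, ({i} : Set (Fin m)).indicator (fun _ => (1 : ℝ)) (J t ω) ∂P = 1 / m := by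
    intro i
    rw [← hJ.uniform t i, ← integral_indicator_one (hJ.measurable t (measurableSet_singleton i))]
    rfl
  have hmeas : ∀ i, AEStronglyMeasurable (Φ i) (P.map fun ω (k : Finset.range t) => J k ω) :=
    fun i => (measurable_of_finite _).aestronglyMeasurable
  have hprod : ∀ i, ∫ ω, Φ i (fun k => J k ω) *
      (({i} : Set (Fin m)).indicator (fun _ => (1 : ℝ)) (J t ω)) ∂P =
      (∫ ω, Φ i (fun k => J k ω) ∂P) * (1 / m) := by
    intro i
    rw [← hone i]
    exact hind.integral_fun_comp_mul_comp hX.aemeasurable (hJ.measurable t).aemeasurable (hmeas i)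
      (measurable_of_finite _).aestronglyMeasurable
  simp only [hsplit]
  rw [integral_finsetSum, integral_const_mul, integral_finsetSum]
  · simp only [hprod, hΦ]
    rw [← Finset.sum_mul, mul_comm]
  · exact fun i _ => (hΨ i).integrable hJ hm
  · intro i _
    have : DependsOnPrefix (t + 1) fun j => Φ i (fun k => j k) *
        (({i} : Set (Fin m)).indicator (fun _ => (1 : ℝ)) (j t)) := by
      intro j j' h
      simp only
      rw [← hΦ, ← hΦ, hΨ i j j' fun k hk => h k (by omega), h t (by omega)]
    exact this.integrable hJ hm

theorem sagaState_congr (G : Fin m → E n → E n) (α : ℝ) (x0 : E n) {j j' : ℕ → Fin m} :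
    ∀ {t : ℕ}, (∀ k < t, j k = j' k) → sagaState G α x0 j t = sagaState G α x0 j' t
  | 0, _ => rfl
  | t + 1, h => by
    simp only [sagaState]
    rw [sagaState_congr G α x0 fun k hk => h k (by omega), h t (by omega)]

theorem dependsOnPrefix_sagaState (G : Fin m → E n → E n) (α : ℝ) (x0 : E n) (t : ℕ)
    (Ψ : E n × (Fin m → E n) → ℝ) :
    DependsOnPrefix t fun j => Ψ (sagaState G α x0 j t) :=
  fun _ _ h => congrArg Ψ (sagaState_congr G α x0 h)

theorem integrable_sagaState [IsProbabilityMeasure P] (hJ : IsUniformSampling P J) (hm : 0 < m)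
    (G : Fin m → E n → E n) (α : ℝ) (x0 : E n) (t : ℕ) (Ψ : E n × (Fin m → E n) → ℝ) :
    Integrable (fun ω => Ψ (sagaState G α x0 (fun k => J k ω) t)) P :=
  (dependsOnPrefix_sagaState G α x0 t Ψ).integrable hJ hm

theorem integral_sagaState_succ [IsProbabilityMeasure P] (hJ : IsUniformSampling P J) (hm : 0 < m)
    (G : Fin m → E n → E n) (α : ℝ) (x0 : E n) (t : ℕ) (Ψ : E n × (Fin m → E n) → ℝ) :
    ∫ ω, Ψ (sagaState G α x0 (fun k => J k ω) (t + 1)) ∂P =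
      ∫ ω, (1 / (m : ℝ)) * ∑ i, Ψ (sagaStep G α (sagaState G α x0 (fun k => J k ω) t) i) ∂P :=
  integral_fresh_index hJ hm (Ψ := fun i j => Ψ (sagaStep G α (sagaState G α x0 j t) i))
    fun i => dependsOnPrefix_sagaState G α x0 t fun s => Ψ (sagaStep G α s i)

/-- Linear convergence of SAGA for strongly convex components. -/
theorem integral_norm_sq_sagaState_le [IsProbabilityMeasure P] (hJ : IsUniformSampling P J)
    (hm : 0 < m) {g : Fin m → E n → ℝ} {G : Fin m → E n → E n} {μ L α : ℝ}
    (hg : ∀ i, QuadBounds (g i) (G i) μ L) (hμ : 0 < μ) (hL : μ < L)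
    (hα : α = 1 / (2 * (μ * m + L))) {z : E n} (hz : ∑ i, G i z = 0) (x0 : E n) :
    ∃ C : ℝ, ∀ t : ℕ,
      ∫ ω, ‖(sagaState G α x0 (fun k => J k ω) t).1 - z‖ ^ 2 ∂P ≤ C * (1 - α * μ) ^ t := by
  have hm' : (1 : ℝ) ≤ m := by exact_mod_cast hm
  have hL0 : 0 < L := hμ.trans hL
  have hα0 : 0 < α := by rw [hα]; positivity
  have hq : 0 < 1 - α * μ := by
    have : α * μ < 1 := by
      rw [hα, div_mul_eq_mul_div, one_mul, div_lt_one (by positivity)]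
      nlinarith
    linarith
  set c := 1 / (2 * α * (1 - α * μ) * m) with hc
  have hc0 : 0 < c := by positivity
  have hT : ∀ t, ∫ ω, lyapunov g G z c (sagaState G α x0 (fun k => J k ω) t) ∂P ≤
      (1 - α * μ) ^ t * lyapunov g G z c (x0, fun _ => x0) := by
    intro t
    induction t with
    | zero => simp [sagaState]
    | succ t ih =>
      rw [integral_sagaState_succ hJ hm]
      calc _ ≤ ∫ ω, (1 - α * μ) * lyapunov g G z c (sagaState G α x0 (fun k => J k ω) t) ∂P :=
            integral_mono
              (integrable_sagaState hJ hm G α x0 t fun s =>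
                (1 / (m : ℝ)) * ∑ i, lyapunov g G z c (sagaStep G α s i))
              ((integrable_sagaState hJ hm G α x0 t _).const_mul _)
              fun ω => average_lyapunov_le_of_strong hm hg hμ hL hα hz _
        _ ≤ _ := by
          rw [integral_const_mul, pow_succ', mul_assoc]
          exact mul_le_mul_of_nonneg_left ih hq.le
  refine ⟨1 / c * lyapunov g G z c (x0, fun _ => x0), fun t => ?_⟩
  calc ∫ ω, ‖(sagaState G α x0 (fun k => J k ω) t).1 - z‖ ^ 2 ∂P
      ≤ ∫ ω, 1 / c * lyapunov g G z c (sagaState G α x0 (fun k => J k ω) t) ∂P := by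
        refine integral_mono (integrable_sagaState hJ hm G α x0 t fun s => ‖s.1 - z‖ ^ 2)
          ((integrable_sagaState hJ hm G α x0 t _).const_mul _) fun ω => ?_
        have := tableGap_nonneg hg hμ.le z (sagaState G α x0 (fun k => J k ω) t).2
        simp only [lyapunov]
        rw [mul_add, ← mul_assoc, one_div_mul_cancel hc0.ne', one_mul]
        have : 0 ≤ 1 / c * tableGap g G z (sagaState G α x0 (fun k => J k ω) t).2 := by positivity
        linarith
    _ ≤ _ := by
      rw [integral_const_mul, mul_assoc, mul_comm (lyapunov g G z c _)]
      exact mul_le_mul_of_nonneg_left (hT t) (by positivity)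

/-- Sublinear convergence of SAGA for convex components: the expected optimality gaps of the
iterates are summable. -/
theorem sum_integral_gap_sagaState_le [IsProbabilityMeasure P] (hJ : IsUniformSampling P J)
    (hm : 0 < m) {g : Fin m → E n → ℝ} {G : Fin m → E n → E n} {L α : ℝ}
    (hg : ∀ i, QuadBounds (g i) (G i) 0 L) (hL : 0 < L)
    (hα : α = 1 / (3 * L)) {z : E n} (hz : ∑ i, G i z = 0) (x0 : E n) :
    ∃ C : ℝ, ∀ t : ℕ, ∑ k ∈ Finset.range t,
      ∫ ω, ((1 / (m : ℝ)) * ∑ i, g i (sagaState G α x0 (fun k => J k ω) k).1 -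
        (1 / (m : ℝ)) * ∑ i, g i z) ∂P ≤ C := by
  have hm' : (0 : ℝ) < m := by exact_mod_cast hm
  have hα0 : 0 < α := by rw [hα]; positivity
  set c := 1 / (α * m) with hc
  have hc0 : 0 < c := by positivity
  have hstep : ∀ t, ∫ ω, ((1 / (m : ℝ)) * ∑ i, g i (sagaState G α x0 (fun k => J k ω) t).1 -
      (1 / (m : ℝ)) * ∑ i, g i z) ∂P ≤
      m * (∫ ω, lyapunov g G z c (sagaState G α x0 (fun k => J k ω) t) ∂P -
        ∫ ω, lyapunov g G z c (sagaState G α x0 (fun k => J k ω) (t + 1)) ∂P) := by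
    intro t
    rw [integral_sagaState_succ hJ hm, ← integral_sub (integrable_sagaState hJ hm G α x0 t _)
      (integrable_sagaState hJ hm G α x0 t fun s =>
        (1 / (m : ℝ)) * ∑ i, lyapunov g G z c (sagaStep G α s i)), ← integral_const_mul]
    refine integral_mono
      (integrable_sagaState hJ hm G α x0 t fun s =>
        (1 / (m : ℝ)) * ∑ i, g i s.1 - (1 / (m : ℝ)) * ∑ i, g i z)
      (integrable_sagaState hJ hm G α x0 t fun s => m * (lyapunov g G z c s -
        (1 / (m : ℝ)) * ∑ i, lyapunov g G z c (sagaStep G α s i))) fun ω => ?_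
    have h := average_lyapunov_le_of_convex hm hg hL hα hz
      (sagaState G α x0 (fun k => J k ω) t)
    simp only
    rw [← hc] at h
    rw [← div_le_iff₀' hm', div_eq_inv_mul, ← one_div]
    linarith
  refine ⟨m * lyapunov g G z c (x0, fun _ => x0), fun t => ?_⟩
  calc _ ≤ ∑ k ∈ Finset.range t,
        m * (∫ ω, lyapunov g G z c (sagaState G α x0 (fun k => J k ω) k) ∂P -
          ∫ ω, lyapunov g G z c (sagaState G α x0 (fun k => J k ω) (k + 1)) ∂P) :=
        Finset.sum_le_sum fun k _ => hstep k
    _ ≤ _ := by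
      rw [← Finset.mul_sum, Finset.sum_range_sub']
      refine mul_le_mul_of_nonneg_left ?_ hm'.le
      have : 0 ≤ ∫ ω, lyapunov g G z c (sagaState G α x0 (fun k => J k ω) t) ∂P :=
        integral_nonneg fun ω =>
          add_nonneg (tableGap_nonneg hg le_rfl z _) (by positivity)
      simpa [sagaState] using this

end Sampling

section Penalty

/-- The one-dimensional profile of the penalty. -/
noncomputable def huber (δ u : ℝ) : ℝ :=
  if δ < u then u else if -δ ≤ u then (u + δ) ^ 2 / (4 * δ) else 0

/-- The derivative of the profile. -/
noncomputable def huberSlope (δ u : ℝ) : ℝ :=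
  if δ < u then 1 else if -δ ≤ u then (u + δ) / (2 * δ) else 0

theorem huber_lower {δ : ℝ} (hδ : 0 < δ) (u v : ℝ) :
    huber δ u + huberSlope δ u * (v - u) ≤ huber δ v := by
  unfold huber huberSlope
  split_ifs <;> field_simp <;> nlinarith [sq_nonneg (u - v)]

theorem huber_upper {δ : ℝ} (hδ : 0 < δ) (u v : ℝ) :
    huber δ v ≤ huber δ u + huberSlope δ u * (v - u) + (v - u) ^ 2 / (4 * δ) := by
  unfold huber huberSlope
  split_ifs <;> field_simp <;> nlinarith

theorem huber_nonneg {δ : ℝ} (hδ : 0 < δ) (u : ℝ) : 0 ≤ huber δ u := by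
  unfold huber
  split_ifs
  · linarith
  · positivity
  · rfl

theorem le_huber {δ : ℝ} (hδ : 0 < δ) (u : ℝ) : u ≤ huber δ u := by
  unfold huber
  split_ifs
  · rfl
  · rw [le_div_iff₀ (by positivity)]
    nlinarith [sq_nonneg (u - δ)]
  · linarith

theorem huber_le_of_nonpos {δ u : ℝ} (hδ : 0 < δ) (hu : u ≤ 0) : huber δ u ≤ δ / 4 := by
  unfold huber
  split_ifs
  · linarith
  · rw [div_le_div_iff₀ (by positivity) (by positivity)]
    nlinarith
  · positivity

theorem lt_huber_of_pos {δ u : ℝ} (hδ : 0 < δ) (hu : 0 < u) : δ / 4 < huber δ u := by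
  unfold huber
  split_ifs
  · linarith
  · rw [div_lt_div_iff₀ (by positivity) (by positivity)]
    nlinarith
  · linarith

theorem huber_eq_zero {δ u : ℝ} (hδ : 0 < δ) (hu : u ≤ -δ) : huber δ u = 0 := by
  unfold huber
  split_ifs with h1 h2
  · linarith
  · have : u = -δ := le_antisymm hu h2
    simp [this]
  · rfl

variable {n m : ℕ}

theorem penalty_eq_huber (δ : ℝ) (a : E n) (b : ℝ) (x : E n) :
    penalty δ a b x = huber δ (inner ℝ a x - b) / ‖a‖ := by
  unfold penalty huber
  split_ifs
  · rfl
  · rw [div_div]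
  · simp

theorem penalty_nonneg {δ : ℝ} (hδ : 0 < δ) (a : E n) (b : ℝ) (x : E n) : 0 ≤ penalty δ a b x := by
  rw [penalty_eq_huber]
  exact div_nonneg (huber_nonneg hδ _) (norm_nonneg _)

/-- The gradient of the penalty. -/
noncomputable def penaltySlope (δ : ℝ) (a : E n) (b : ℝ) (x : E n) : E n :=
  (huberSlope δ (inner ℝ a x - b) / ‖a‖) • a

theorem quadBounds_penalty {δ : ℝ} (hδ : 0 < δ) {a : E n} (ha : a ≠ 0) (b : ℝ) :
    QuadBounds (penalty δ a b) (penaltySlope δ a b) 0 (‖a‖ / (2 * δ)) where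
  lower x y := by
    have hn : 0 < ‖a‖ := norm_pos_iff.2 ha
    have h := huber_lower hδ (inner ℝ a x - b) (inner ℝ a y - b)
    rw [penalty_eq_huber, penalty_eq_huber, penaltySlope, real_inner_smul_left, inner_sub_right,
      zero_div, zero_mul, add_zero, div_mul_eq_mul_div, ← add_div]
    refine div_le_div_of_nonneg_right (le_trans (le_of_eq ?_) h) hn.le
    ring
  upper x y := by
    have hn : 0 < ‖a‖ := norm_pos_iff.2 ha
    have h := huber_upper hδ (inner ℝ a x - b) (inner ℝ a y - b)
    have hcs : (inner ℝ a y - b - (inner ℝ a x - b)) ^ 2 ≤ ‖a‖ ^ 2 * ‖y - x‖ ^ 2 := by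
      have : inner ℝ a y - b - (inner ℝ a x - b) = inner ℝ a (y - x) := by
        rw [inner_sub_right]; ring
      rw [this, ← mul_pow]
      exact sq_le_sq' (neg_le_of_abs_le (abs_real_inner_le_norm _ _)) (real_inner_le_norm _ _)
    have e : ‖a‖ / (2 * δ) / 2 * ‖y - x‖ ^ 2 = ‖a‖ ^ 2 * ‖y - x‖ ^ 2 / (4 * δ) / ‖a‖ := by
      field_simp; ring
    rw [penalty_eq_huber, penalty_eq_huber, penaltySlope, real_inner_smul_left, inner_sub_right,
      e, div_mul_eq_mul_div, ← add_div, ← add_div]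
    refine div_le_div_of_nonneg_right (h.trans ?_) hn.le
    have : (inner ℝ a y - b - (inner ℝ a x - b)) ^ 2 / (4 * δ) ≤
        ‖a‖ ^ 2 * ‖y - x‖ ^ 2 / (4 * δ) := by gcongr
    have e2 : (inner ℝ a y - b - (inner ℝ a x - b)) = inner ℝ a y - inner ℝ a x := by ring
    rw [e2] at this ⊢
    linarith

theorem gradient_penalty {δ : ℝ} (hδ : 0 < δ) {a : E n} (ha : a ≠ 0) (b : ℝ) (x : E n) :
    gradient (penalty δ a b) x = penaltySlope δ a b x :=
  ((quadBounds_penalty hδ ha b).hasGradientAt x).gradient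

theorem alphaMin_le (a : Fin m → E n) (i : Fin m) : alphaMin a ≤ ‖a i‖ :=
  ciInf_le (Set.finite_range _).bddBelow i

theorem le_alphaMax (a : Fin m → E n) (i : Fin m) : ‖a i‖ ≤ alphaMax a :=
  le_ciSup (f := fun j => ‖a j‖) (Set.finite_range _).bddAbove i

theorem alphaMin_pos (hm : 0 < m) {a : Fin m → E n} (ha : ∀ i, a i ≠ 0) : 0 < alphaMin a := by
  have : Nonempty (Fin m) := ⟨⟨0, hm⟩⟩
  obtain ⟨i, hi⟩ := exists_eq_ciInf_of_finite (f := fun j => ‖a j‖)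
  rw [alphaMin, ← hi]
  exact norm_pos_iff.2 (ha i)

end Penalty

section Smooth

variable {n m : ℕ} {f : E n → ℝ}

theorem hasDerivAt_comp_line (hf : Differentiable ℝ f) (x d : E n) (s : ℝ) :
    HasDerivAt (fun s : ℝ => f (x + s • d)) (inner ℝ (gradient f (x + s • d)) d) s := by
  have h1 := (hf (x + s • d)).hasGradientAt.hasFDerivAt
  have h2 : HasDerivAt (fun s : ℝ => x + s • d) d s := by
    simpa using ((hasDerivAt_id s).smul_const d).const_add x
  exact (h1.comp_hasDerivAt s h2).congr_deriv (by simp)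

/-- The descent lemma. -/
theorem HasLipschitzGradient.le_quadratic {L : ℝ} (hf : HasLipschitzGradient f L) (x y : E n) :
    f y ≤ f x + inner ℝ (gradient f x) (y - x) + L / 2 * ‖y - x‖ ^ 2 := by
  set d := y - x with hd
  have hder : ∀ s : ℝ, HasDerivAt
      (fun s : ℝ => f (x + s • d) - s * inner ℝ (gradient f x) d - L / 2 * s ^ 2 * ‖d‖ ^ 2)
      (inner ℝ (gradient f (x + s • d)) d - inner ℝ (gradient f x) d - L * s * ‖d‖ ^ 2) s := by
    intro s
    have h1 := hasDerivAt_comp_line hf.1 x d s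
    have h2 := (hasDerivAt_id s).mul_const (inner ℝ (gradient f x) d)
    have h3 := (((hasDerivAt_id s).pow 2).const_mul (L / 2)).mul_const (‖d‖ ^ 2)
    refine ((h1.sub h2).sub h3).congr_deriv ?_
    simp only [id_eq, one_mul, Nat.cast_ofNat, Nat.add_one_sub_one, pow_one, mul_one]
    ring
  have hanti := antitoneOn_of_deriv_nonpos (convex_Icc (0 : ℝ) 1)
    (fun s _ => (hder s).continuousAt.continuousWithinAt)
    (fun s _ => (hder s).differentiableAt.differentiableWithinAt) (fun s hs => by
      rw [interior_Icc] at hs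
      rw [(hder s).deriv, ← inner_sub_left]
      have h1 := real_inner_le_norm (gradient f (x + s • d) - gradient f x) d
      have h2 := hf.2 (x + s • d) x
      rw [add_sub_cancel_left, norm_smul, Real.norm_eq_abs, abs_of_pos hs.1] at h2
      have h3 := mul_le_mul_of_nonneg_right h2 (norm_nonneg d)
      nlinarith)
  have h := hanti (Set.left_mem_Icc.2 zero_le_one) (Set.right_mem_Icc.2 zero_le_one) zero_le_one
  have e : x + d = y := by rw [hd]; abel
  simp only [one_smul, e, zero_smul, add_zero] at h
  linarith

theorem quadBounds_of_strongConvexOn {μ L : ℝ} (hμ : StrongConvexOn Set.univ μ f)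
    (hf : HasLipschitzGradient f L) : QuadBounds f (gradient f) μ L where
  upper := hf.le_quadratic
  lower x y := by
    set d := y - x with hd
    have hconv : ConvexOn ℝ Set.univ
        (fun s : ℝ => f (x + s • d) - μ / 2 * ‖x + s • d‖ ^ 2) := by
      have h := (strongConvexOn_iff_convex.1 hμ).comp_affineMap (AffineMap.lineMap x y)
      simpa [Function.comp_def, AffineMap.lineMap_apply, hd, add_comm] using h
    have hnorm : ∀ s : ℝ, ‖x + s • d‖ ^ 2 = ‖x‖ ^ 2 + 2 * s * inner ℝ x d + s ^ 2 * ‖d‖ ^ 2 := by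
      intro s
      rw [norm_add_sq_real, real_inner_smul_right, norm_smul, mul_pow, Real.norm_eq_abs, sq_abs]
      ring
    simp only [hnorm] at hconv
    have hder : HasDerivAt (fun s : ℝ => f (x + s • d) -
        μ / 2 * (‖x‖ ^ 2 + 2 * s * inner ℝ x d + s ^ 2 * ‖d‖ ^ 2))
        (inner ℝ (gradient f x) d - μ * inner ℝ x d) 0 := by
      have h1 := hasDerivAt_comp_line hf.1 x d 0
      have h2 := ((((hasDerivAt_id (0 : ℝ)).const_mul 2).mul_const (inner ℝ x d)).const_add
        (‖x‖ ^ 2)).add (((hasDerivAt_id (0 : ℝ)).pow 2).mul_const (‖d‖ ^ 2))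
      refine (h1.sub (h2.const_mul (μ / 2))).congr_deriv ?_
      simp
      ring
    have h := hconv.le_slope_of_hasDerivAt (Set.mem_univ 0) (Set.mem_univ 1) zero_lt_one hder
    have e : x + d = y := by rw [hd]; abel
    simp only [slope_def_field, one_smul, e, zero_smul, add_zero, sub_zero, div_one] at h
    linarith

theorem quadBounds_of_convexOn {L : ℝ} (hconv : ConvexOn ℝ Set.univ f)
    (hf : HasLipschitzGradient f L) : QuadBounds f (gradient f) 0 L :=
  quadBounds_of_strongConvexOn (by simpa using hconv) hf

theorem quadBounds_compGrad {a : Fin m → E n} {b : Fin m → ℝ} (ha : ∀ i, a i ≠ 0) {μ L γ δ : ℝ}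
    (hγ : 0 ≤ γ) (hδ : 0 < δ) (hf : QuadBounds f (gradient f) μ L) (i : Fin m) :
    QuadBounds (fun x => f x + γ * penalty δ (a i) (b i) x) (compGrad f a b γ δ i) μ
      (L + γ * alphaMax a / (2 * δ)) := by
  have h := hf.add ((quadBounds_penalty hδ (ha i) (b i)).const_mul hγ)
  have e : compGrad f a b γ δ i = fun x => gradient f x + γ • penaltySlope δ (a i) (b i) x := by
    funext x
    rw [compGrad, gradient_penalty hδ (ha i)]
  rw [e]
  refine h.mono (by simp) ?_
  rw [mul_div_assoc]
  have := le_alphaMax a i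
  gcongr

theorem average_add_penalty (hm : 0 < m) (a : Fin m → E n) (b : Fin m → ℝ) (γ δ : ℝ) (x : E n) :
    (1 / (m : ℝ)) * ∑ i, (f x + γ * penalty δ (a i) (b i) x) = penObj f a b γ δ x := by
  have hm' : (m : ℝ) ≠ 0 := by exact_mod_cast hm.ne'
  rw [Finset.sum_add_distrib, ← Finset.mul_sum, penObj]
  simp
  field_simp

theorem quadBounds_penObj (hm : 0 < m) {a : Fin m → E n} {b : Fin m → ℝ} (ha : ∀ i, a i ≠ 0)
    {μ L γ δ : ℝ} (hγ : 0 ≤ γ) (hδ : 0 < δ) (hf : QuadBounds f (gradient f) μ L) :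
    QuadBounds (penObj f a b γ δ) (fun x => (1 / (m : ℝ)) • ∑ i, compGrad f a b γ δ i x) μ
      (L + γ * alphaMax a / (2 * δ)) := by
  have h := QuadBounds.average hm (quadBounds_compGrad (b := b) ha hγ hδ hf)
  simpa only [average_add_penalty hm] using h

theorem le_penObj (a : Fin m → E n) (b : Fin m → ℝ) {γ δ : ℝ} (hγ : 0 ≤ γ) (hδ : 0 < δ) (x : E n) :
    f x ≤ penObj f a b γ δ x :=
  le_add_of_nonneg_right (mul_nonneg (by positivity)
    (Finset.sum_nonneg fun i _ => penalty_nonneg hδ _ _ _))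

theorem penObj_le_of_mem_feasible (hm : 0 < m) {a : Fin m → E n} (ha : ∀ i, a i ≠ 0)
    {b : Fin m → ℝ} {γ δ : ℝ} (hγ : 0 ≤ γ) (hδ : 0 < δ) {x : E n} (hx : x ∈ feasible a b) :
    penObj f a b γ δ x ≤ f x + γ * δ / (4 * alphaMin a) := by
  have hm' : (0 : ℝ) < m := by exact_mod_cast hm
  have hA := alphaMin_pos hm ha
  have h : ∑ i, penalty δ (a i) (b i) x ≤ ∑ _i : Fin m, δ / (4 * alphaMin a) := by
    refine Finset.sum_le_sum fun i _ => ?_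
    have hi : inner ℝ (a i) x - b i ≤ 0 := Set.mem_iInter.1 hx i
    rw [penalty_eq_huber, ← div_div]
    exact div_le_div₀ (by positivity) (huber_le_of_nonpos hδ hi) hA (alphaMin_le a i)
  simp only [Finset.sum_const, Finset.card_univ, Fintype.card_fin, nsmul_eq_mul] at h
  have h2 := mul_le_mul_of_nonneg_left h (by positivity : 0 ≤ γ / m)
  have e : γ / m * (m * (δ / (4 * alphaMin a))) = γ * δ / (4 * alphaMin a) := by field_simp
  rw [e] at h2
  exact add_le_add_right h2 _

theorem exists_forall_le_of_isBounded {F : E n → ℝ} (hF : Continuous F)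
    (hfF : ∀ x, f x ≤ F x) (hlev : ∀ r : ℝ, Bornology.IsBounded {x | f x ≤ r}) :
    ∃ x, ∀ y, F x ≤ F y := by
  have hcomp : IsCompact {x | F x ≤ F 0} :=
    Metric.isCompact_of_isClosed_isBounded (isClosed_le hF continuous_const)
      ((hlev (F 0)).subset fun x hx => (hfF x).trans hx)
  obtain ⟨x, hx, hmin⟩ := hcomp.exists_isMinOn ⟨0, le_refl (F 0)⟩ hF.continuousOn
  refine ⟨x, fun y => ?_⟩
  by_cases hy : F y ≤ F 0
  · exact hmin hy
  · exact le_trans hx (not_le.1 hy).le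

theorem QuadBounds.isBounded_sublevel {G : E n → E n} {μ L : ℝ} (hf : QuadBounds f G μ L)
    (hμ : 0 < μ) (r : ℝ) : Bornology.IsBounded {x | f x ≤ r} := by
  refine isBounded_iff_forall_norm_le.2 ⟨1 + 2 * (‖G 0‖ + |f 0 - r|) / μ, fun x hx => ?_⟩
  have hx' : f x ≤ r := hx
  have h := hf.lower 0 x
  rw [sub_zero] at h
  have h1 := neg_le_of_abs_le (abs_real_inner_le_norm (G 0) x)
  have h2 := neg_abs_le (f 0 - r)
  by_cases hx1 : ‖x‖ ≤ 1
  · have : 0 ≤ 2 * (‖G 0‖ + |f 0 - r|) / μ := by positivity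
    linarith
  · push Not at hx1
    have h3 : ‖x‖ ≤ 2 * (‖G 0‖ + |f 0 - r|) / μ := by
      rw [le_div_iff₀ hμ]
      have h4 : |f 0 - r| ≤ |f 0 - r| * ‖x‖ := le_mul_of_one_le_right (abs_nonneg _) hx1.le
      have h5 : (‖x‖ * μ) * ‖x‖ ≤ (2 * (‖G 0‖ + |f 0 - r|)) * ‖x‖ := by nlinarith
      exact le_of_mul_le_mul_right h5 (by linarith)
    linarith

theorem QuadBounds.continuous {F : E n → ℝ} {G : E n → E n} {μ L : ℝ} (hF : QuadBounds F G μ L)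
    (hμ : 0 ≤ μ) : Continuous F :=
  continuous_iff_continuousAt.2 fun x =>
    ((hF.mono hμ le_rfl).hasGradientAt x).differentiableAt.continuousAt

theorem penSolutions_nonempty (hm : 0 < m) {a : Fin m → E n} {b : Fin m → ℝ} (ha : ∀ i, a i ≠ 0)
    {L γ δ : ℝ} (hγ : 0 ≤ γ) (hδ : 0 < δ) (hf : QuadBounds f (gradient f) 0 L)
    (hlev : ∀ r : ℝ, Bornology.IsBounded {x | f x ≤ r}) :
    ∃ x, x ∈ penSolutions f a b γ δ :=
  exists_forall_le_of_isBounded ((quadBounds_penObj hm ha hγ hδ hf).continuous le_rfl)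
    (le_penObj a b hγ hδ) hlev

theorem sum_compGrad_eq_zero (hm : 0 < m) {a : Fin m → E n} {b : Fin m → ℝ} (ha : ∀ i, a i ≠ 0)
    {μ L γ δ : ℝ} (hL : 0 < L) (hγ : 0 ≤ γ) (hδ : 0 < δ) (hf : QuadBounds f (gradient f) μ L)
    {z : E n} (hz : z ∈ penSolutions f a b γ δ) : ∑ i, compGrad f a b γ δ i z = 0 := by
  have hm' : (m : ℝ) ≠ 0 := by exact_mod_cast hm.ne'
  have hA : 0 ≤ alphaMax a := (norm_nonneg _).trans (le_alphaMax a ⟨0, hm⟩)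
  have h := (quadBounds_penObj hm ha hγ hδ hf).slope_eq_zero (by positivity) hz
  simpa [hm'] using h

end Smooth

section Exactness

variable {n m : ℕ} {f : E n → ℝ} {a : Fin m → E n} {b : Fin m → ℝ}

theorem isClosed_feasible (a : Fin m → E n) (b : Fin m → ℝ) : IsClosed (feasible a b) :=
  isClosed_iInter fun i => isClosed_le (by fun_prop) continuous_const

theorem proj_spec {Y : Set (E n)} (hY : IsClosed Y) (hne : Y.Nonempty) (x : E n) :
    proj Y x ∈ Y ∧ ‖x - proj Y x‖ = Metric.infDist x Y := by
  have h : ∃ p ∈ Y, ‖x - p‖ = Metric.infDist x Y := by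
    obtain ⟨p, hp, hd⟩ := hY.exists_infDist_eq_dist hne x
    exact ⟨p, hp, by rw [hd, dist_eq_norm]⟩
  rw [proj, dif_pos h]
  exact h.choose_spec

theorem norm_sub_proj_le {Y : Set (E n)} (hY : IsClosed Y) {p : E n} (hp : p ∈ Y) (x : E n) :
    ‖x - proj Y x‖ ≤ ‖x - p‖ := by
  rw [(proj_spec hY ⟨p, hp⟩ x).2, ← dist_eq_norm]
  exact Metric.infDist_le_dist_of_mem hp

theorem infDist_halfSpace_le {a : E n} (ha : a ≠ 0) {b r : ℝ} (hr : 0 ≤ r) {x : E n}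
    (hx : inner ℝ a x - b ≤ r) : Metric.infDist x (halfSpace a b) ≤ r / ‖a‖ := by
  have hn : 0 < ‖a‖ := norm_pos_iff.2 ha
  have hmem : x - (r / ‖a‖ ^ 2) • a ∈ halfSpace a b := by
    change inner ℝ a (x - (r / ‖a‖ ^ 2) • a) - b ≤ 0
    rw [inner_sub_right, real_inner_smul_right, real_inner_self_eq_norm_sq,
      div_mul_cancel₀ _ (by positivity)]
    linarith
  refine (Metric.infDist_le_dist_of_mem hmem).trans (le_of_eq ?_)
  rw [dist_eq_norm, sub_sub_cancel, norm_smul, Real.norm_eq_abs, abs_of_nonneg (by positivity)]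
  field_simp

theorem infDist_halfSpace_le_penalty {δ : ℝ} (hδ : 0 < δ) {a : E n} (ha : a ≠ 0) (b : ℝ)
    (x : E n) : Metric.infDist x (halfSpace a b) ≤ penalty δ a b x := by
  rw [penalty_eq_huber]
  exact infDist_halfSpace_le ha (huber_nonneg hδ _) (le_huber hδ _)

/-- Every feasible point is close to a point where no constraint is penalized. -/
theorem exists_unpenalized_near (hm : 0 < m) (ha : ∀ i, a i ≠ 0) {ε δ β : ℝ}
    (hint : ∃ x : E n, ∀ j, inner ℝ (a j) x - b j ≤ -ε) (hδ : 0 < δ) (hδε : δ ≤ ε)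
    (hβ : IsHoffmanConst a β) {p : E n} (hp : p ∈ feasible a b) :
    ∃ z ∈ feasible a b, (∀ j, penalty δ (a j) (b j) z = 0) ∧
      ‖p - z‖ ≤ β * m * δ / alphaMin a := by
  have hA := alphaMin_pos hm ha
  have hne : (feasible a fun i => b i - δ).Nonempty := by
    obtain ⟨x, hx⟩ := hint
    refine ⟨x, Set.mem_iInter.2 fun i => ?_⟩
    change inner ℝ (a i) x - (b i - δ) ≤ 0
    linarith [hx i]
  obtain ⟨hz, hd⟩ := proj_spec (isClosed_feasible a _) hne p
  set z := proj (feasible a fun i => b i - δ) p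
  have hzi : ∀ i, inner ℝ (a i) z - b i ≤ -δ := by
    intro i
    have : inner ℝ (a i) z - (b i - δ) ≤ 0 := Set.mem_iInter.1 hz i
    linarith
  refine ⟨z, Set.mem_iInter.2 fun i => ?_, fun j => ?_, ?_⟩
  · change inner ℝ (a i) z - b i ≤ 0
    linarith [hzi i]
  · rw [penalty_eq_huber, huber_eq_zero hδ (hzi j), zero_div]
  · rw [hd]
    refine (hβ.2 _ hne p).trans ?_
    have h : ∑ i, Metric.infDist p (halfSpace (a i) (b i - δ)) ≤
        ∑ _i : Fin m, δ / alphaMin a := by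
      refine Finset.sum_le_sum fun i _ => ?_
      have hi : inner ℝ (a i) p - b i ≤ 0 := Set.mem_iInter.1 hp i
      refine (infDist_halfSpace_le (ha i) hδ.le (by linarith)).trans ?_
      exact div_le_div_of_nonneg_left hδ.le hA (alphaMin_le a i)
    simp only [Finset.sum_const, Finset.card_univ, Fintype.card_fin, nsmul_eq_mul] at h
    refine (mul_le_mul_of_nonneg_left h hβ.1.le).trans (le_of_eq ?_)
    ring

theorem eq_gradient_of_mem_subdiff {L : ℝ} (hL : 0 < L) (hf : HasLipschitzGradient f L)
    {x s : E n} (hs : s ∈ subdiff f x) : s = gradient f x := by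
  have h1 := hs (x + (1 / L) • (s - gradient f x))
  have h2 := hf.le_quadratic x (x + (1 / L) • (s - gradient f x))
  rw [add_sub_cancel_left] at h1 h2
  have h3 : inner ℝ (s - gradient f x) ((1 / L) • (s - gradient f x)) ≤
      L / 2 * ‖(1 / L) • (s - gradient f x)‖ ^ 2 := by
    rw [inner_sub_left]
    linarith
  rw [real_inner_smul_right, real_inner_self_eq_norm_sq, norm_smul, mul_pow, Real.norm_eq_abs,
    sq_abs] at h3
  have h4 : L / 2 * ((1 / L) ^ 2 * ‖s - gradient f x‖ ^ 2) =
      1 / L * ‖s - gradient f x‖ ^ 2 / 2 := by field_simp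
  have h5 : 1 / L * ‖s - gradient f x‖ ^ 2 ≤ 0 := by linarith
  have h6 : ‖s - gradient f x‖ ^ 2 ≤ 0 := nonpos_of_mul_nonpos_right h5 (by positivity)
  exact sub_eq_zero.1 (by simpa using h6)

theorem norm_gradient_le_subgradBound {L : ℝ} (hL : 0 < L) (hf : HasLipschitzGradient f L)
    (hq : QuadBounds f (gradient f) 0 L) {R : ℝ} {z : E n} (hz : ‖z‖ ≤ R) :
    ‖gradient f z‖ ≤ subgradBound f R := by
  refine le_csSup ⟨‖gradient f 0‖ + L * R, ?_⟩ ⟨z, gradient f z, hz, fun y => ?_, rfl⟩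
  · rintro r ⟨x, s, hx, hs, rfl⟩
    rw [eq_gradient_of_mem_subdiff hL hf hs]
    have h1 := hf.2 x 0
    rw [sub_zero] at h1
    have h2 := norm_le_norm_add_norm_sub (gradient f 0) (gradient f x)
    rw [norm_sub_rev] at h2
    have h3 := mul_le_mul_of_nonneg_left hx hL.le
    linarith
  · simpa using hq.lower z y

theorem subgradBound_nonneg (f : E n → ℝ) (R : ℝ) : 0 ≤ subgradBound f R :=
  Real.sSup_nonneg (by rintro r ⟨x, s, -, -, rfl⟩; exact norm_nonneg s)

/-- Exactness of the penalty: for admissible parameters the penalized solutions are feasible. -/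
theorem mem_feasible_of_mem_penSolutions (hm : 0 < m) (ha : ∀ i, a i ≠ 0) {ε β L κ γ δ : ℝ}
    (hint : ∃ x : E n, ∀ j, inner ℝ (a j) x - b j ≤ -ε) (hβ : IsHoffmanConst a β) (hL : 0 < L)
    (hf : HasLipschitzGradient f L) (hq : QuadBounds f (gradient f) 0 L)
    (hadm : AdmissibleParams f a b β ε κ γ δ) {x : E n} (hx : x ∈ penSolutions f a b γ δ) :
    x ∈ feasible a b := by
  obtain ⟨hγ, hδ, hδmin, hγκ, c, R, hκc, hR, hΓ⟩ := hadm
  have hm' : (1 : ℝ) ≤ m := by exact_mod_cast hm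
  have hm0 : (0 : ℝ) < m := by linarith
  have hA := alphaMin_pos hm ha
  have hAB : alphaMin a ≤ alphaMax a := (alphaMin_le a ⟨0, hm⟩).trans (le_alphaMax a ⟨0, hm⟩)
  have hB : 0 < alphaMax a := hA.trans_le hAB
  have hβ0 := hβ.1
  have hδε : δ < ε := hδmin.trans_le (min_le_left _ _)
  have hδ2 : δ < 16 * alphaMin a ^ 2 / (β ^ 2 * m ^ 2) := hδmin.trans_le (min_le_right _ _)
  have hγδ : γ * δ ≤ c := ((le_div_iff₀ hδ).1 hγκ).trans hκc.le
  have hne : (feasible a b).Nonempty := by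
    obtain ⟨y, hy⟩ := hint
    refine ⟨y, Set.mem_iInter.2 fun i => ?_⟩
    change inner ℝ (a i) y - b i ≤ 0
    linarith [hy i]
  by_contra hxX
  obtain ⟨hpX, hpd⟩ := proj_spec (isClosed_feasible a b) hne x
  obtain ⟨z, hzX, hz0, hpz⟩ := exists_unpenalized_near hm ha hint hδ hδε.le hβ hpX
  have hxz : ‖x - z‖ ≤ ‖x - proj (feasible a b) x‖ + β * m * δ / alphaMin a := by
    have := norm_sub_le_norm_sub_add_norm_sub x (proj (feasible a b) x) z
    linarith
  have hzR : ‖z‖ ≤ R := (hR γ δ hγ hδ hδε.le hγδ x hx).2 hxX z hzX hz0 hxz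
  have hgrad := norm_gradient_le_subgradBound hL hf hq hzR
  have hLs := subgradBound_nonneg f R
  set Ls := subgradBound f R
  set d := ‖x - proj (feasible a b) x‖
  set A := alphaMin a
  set B := alphaMax a
  set S := ∑ i, penalty δ (a i) (b i) x with hS
  -- comparison with the unpenalized point
  have h1 : γ / m * S ≤ Ls * (d + β * m * δ / A) := by
    have hFz : penObj f a b γ δ z = f z := by simp [penObj, hz0]
    have hFx : f x + γ / m * S ≤ f z := by
      rw [← hFz]
      exact hx z
    have hlow := hq.lower z x
    have hin := neg_le_of_abs_le (abs_real_inner_le_norm (gradient f z) (x - z))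
    have hprod : ‖gradient f z‖ * ‖x - z‖ ≤ Ls * (d + β * m * δ / A) :=
      mul_le_mul hgrad hxz (norm_nonneg _) hLs
    linarith
  -- error bound
  have h2 : d ≤ β * S := by
    rw [hpd]
    exact (hβ.2 b hne x).trans (mul_le_mul_of_nonneg_left (Finset.sum_le_sum fun i _ =>
      infDist_halfSpace_le_penalty hδ (ha i) (b i) x) hβ0.le)
  -- a violated constraint has a penalty bounded below
  have h3 : δ / (4 * B) < S := by
    have : ∃ i, 0 < inner ℝ (a i) x - b i := by
      by_contra! hall
      exact hxX (Set.mem_iInter.2 hall)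
    obtain ⟨i, hi⟩ := this
    have hpi : δ / (4 * B) < penalty δ (a i) (b i) x := by
      have hn : 0 < ‖a i‖ := norm_pos_iff.2 (ha i)
      rw [penalty_eq_huber, ← div_div]
      exact div_lt_div₀ (lt_huber_of_pos hδ hi) (le_alphaMax a i) (huber_nonneg hδ _) hn
    exact hpi.trans_le (Finset.single_le_sum (f := fun i => penalty δ (a i) (b i) x)
      (fun i _ => penalty_nonneg hδ _ _ _) (Finset.mem_univ i))
  have hG1 : Ls * (1 / (m * β) - √δ / (4 * A))⁻¹ ≤ γ := (le_max_left _ _).trans hΓ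
  have hG2 : 4 * m * Ls * B * (1 / √δ + β * m / A) ≤ γ := (le_max_right _ _).trans hΓ
  have hsq : 0 < √δ := Real.sqrt_pos.2 hδ
  have hss : √δ * √δ = δ := Real.mul_self_sqrt hδ.le
  rcases le_or_gt d √δ with hd | hd
  · have k1 : γ / m * (δ / (4 * B)) < Ls * (√δ + β * m * δ / A) :=
      calc γ / m * (δ / (4 * B)) < γ / m * S := mul_lt_mul_of_pos_left h3 (by positivity)
        _ ≤ _ := h1
        _ ≤ _ := by gcongr
    have k2 := mul_le_mul_of_nonneg_right hG2 (by positivity : 0 ≤ δ / (4 * B * m))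
    have e1 : 4 * m * Ls * B * (1 / √δ + β * m / A) * (δ / (4 * B * m)) =
        Ls * (√δ + β * m * δ / A) := by
      have : δ / √δ = √δ := Real.div_sqrt
      calc _ = Ls * (δ / √δ + β * m * δ / A) := by field_simp
        _ = _ := by rw [this]
    have e2 : γ * (δ / (4 * B * m)) = γ / m * (δ / (4 * B)) := by field_simp
    rw [e1, e2] at k2
    linarith
  · have hk : 0 < 1 / (m * β) - √δ / (4 * A) := by
      have : √δ < 4 * A / (β * m) := by
        rw [Real.sqrt_lt' (by positivity), div_pow, mul_pow, mul_pow]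
        norm_num
        exact hδ2
      have h4 : √δ / (4 * A) < 4 * A / (β * m) / (4 * A) := by gcongr
      have e : 4 * A / (β * m) / (4 * A) = 1 / (m * β) := by field_simp
      linarith
    have hLk : Ls ≤ γ * (1 / (m * β) - √δ / (4 * A)) := by
      rwa [← div_eq_mul_inv, div_le_iff₀ hk] at hG1
    have hd0 : 0 < d := hsq.trans hd
    have k1 : γ * d / (m * β) ≤ Ls * (d + β * m * δ / A) := by
      refine le_trans ?_ h1
      have := mul_le_mul_of_nonneg_left h2 (by positivity : 0 ≤ γ / (m * β))
      calc γ * d / (m * β) = γ / (m * β) * d := by ring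
        _ ≤ _ := this
        _ = _ := by field_simp
    have k2 := mul_le_mul_of_nonneg_right hLk hd0.le
    have k3 : γ * √δ * d / (4 * A) ≤ Ls * (β * m * δ / A) := by
      have : γ * (1 / (m * β) - √δ / (4 * A)) * d = γ * d / (m * β) - γ * √δ * d / (4 * A) := by
        ring
      linarith
    have k4 : γ * √δ * √δ / (4 * A) < Ls * (β * m * δ / A) :=
      lt_of_lt_of_le (by gcongr) k3
    have k5 : γ < 4 * m * Ls * β := by
      rw [mul_assoc γ, hss] at k4
      have e1 : γ * δ / (4 * A) = γ * (δ / (4 * A)) := by ring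
      have e2 : Ls * (β * m * δ / A) = (4 * m * Ls * β) * (δ / (4 * A)) := by
        field_simp
      rw [e1, e2] at k4
      exact lt_of_mul_lt_mul_right k4 (by positivity)
    have k6 : 4 * m * Ls * β ≤ 4 * m * Ls * B * (1 / √δ + β * m / A) := by
      have h5 : β ≤ B * (β * m / A) := by
        rw [mul_div_assoc', le_div_iff₀ hA]
        calc β * A ≤ β * B := by gcongr
          _ ≤ B * (β * m) := by nlinarith [mul_pos hβ0 hB]
      have h6 : 0 ≤ B * (1 / √δ) := by positivity
      calc 4 * m * Ls * β ≤ 4 * m * Ls * (B * (1 / √δ + β * m / A)) := by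
            gcongr
            linarith
        _ = _ := by ring
    linarith

end Exactness

section Averages

variable {n m : ℕ} {Ω : Type*} [MeasurableSpace Ω] {P : Measure Ω} {J : ℕ → Ω → Fin m}

theorem QuadBounds.map_average_le {F : E n → ℝ} {G : E n → E n} {L : ℝ}
    (hF : QuadBounds F G 0 L) {t : ℕ} (ht : 1 ≤ t) (x : ℕ → E n) :
    F ((1 / (t : ℝ)) • ∑ k ∈ Finset.Icc 1 t, x k) ≤
      (1 / (t : ℝ)) * ∑ k ∈ Finset.Icc 1 t, F (x k) := by
  have ht' : (0 : ℝ) < t := by exact_mod_cast ht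
  set y := (1 / (t : ℝ)) • ∑ k ∈ Finset.Icc 1 t, x k with hy
  have h := Finset.sum_le_sum fun k (_ : k ∈ Finset.Icc 1 t) => hF.lower y (x k)
  have hsum : ∑ k ∈ Finset.Icc 1 t, (x k - y) = 0 := by
    rw [Finset.sum_sub_distrib, Finset.sum_const, Nat.card_Icc, Nat.add_sub_cancel,
      ← Nat.cast_smul_eq_nsmul ℝ, hy, smul_smul, mul_one_div_cancel ht'.ne', one_smul, sub_self]
  simp only [Finset.sum_add_distrib, ← inner_sum, hsum, inner_zero_right, Finset.sum_const,
    Nat.card_Icc, Nat.add_sub_cancel, nsmul_eq_mul, zero_div, zero_mul, add_zero] at h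
  rw [one_div, ← div_eq_inv_mul, le_div_iff₀ ht', mul_comm]
  exact h

theorem integrable_avgIter [IsProbabilityMeasure P] (hJ : IsUniformSampling P J) (hm : 0 < m)
    (f : E n → ℝ) (a : Fin m → E n) (b : Fin m → ℝ) (γ δ α : ℝ) (x0 : E n) (t : ℕ)
    (Ψ : E n → ℝ) :
    Integrable (fun ω => Ψ (avgIter f a b γ δ α x0 (fun k => J k ω) t)) P := by
  have h : DependsOnPrefix t fun j => Ψ (avgIter f a b γ δ α x0 j t) := by
    intro j j' hj
    simp only [avgIter, iter]
    congr 2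
    refine Finset.sum_congr rfl fun k hk => ?_
    rw [sagaState_congr _ α x0 fun l hl => hj l (hl.trans_le (Finset.mem_Icc.1 hk).2)]
  exact h.integrable hJ hm

/-- The averaged iterates converge in value at rate `1 / t`. -/
theorem integral_penObj_avgIter_le [IsProbabilityMeasure P] (hJ : IsUniformSampling P J)
    (hm : 0 < m) {f : E n → ℝ} {a : Fin m → E n} {b : Fin m → ℝ} (ha : ∀ i, a i ≠ 0)
    {L γ δ α : ℝ} (hL : 0 < L) (hγ : 0 < γ) (hδ : 0 < δ) (hf : QuadBounds f (gradient f) 0 L)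
    (hα : α = 1 / (3 * (L + γ * alphaMax a / (2 * δ)))) {z : E n}
    (hz : z ∈ penSolutions f a b γ δ) (x0 : E n) :
    ∃ C : ℝ, ∀ t : ℕ, 1 ≤ t →
      ∫ ω, penObj f a b γ δ (avgIter f a b γ δ α x0 (fun k => J k ω) t) ∂P -
        penObj f a b γ δ z ≤ C / t := by
  have hB : 0 ≤ alphaMax a := (norm_nonneg _).trans (le_alphaMax a ⟨0, hm⟩)
  obtain ⟨C, hC⟩ := sum_integral_gap_sagaState_le hJ hm
    (quadBounds_compGrad (b := b) ha hγ.le hδ hf) (by positivity) hα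
    (sum_compGrad_eq_zero hm ha hL hγ.le hδ hf hz) x0
  simp only [average_add_penalty hm] at hC
  have hnn : ∀ k, 0 ≤ ∫ ω, (penObj f a b γ δ (sagaState (compGrad f a b γ δ) α x0
      (fun k => J k ω) k).1 - penObj f a b γ δ z) ∂P :=
    fun k => integral_nonneg fun ω => sub_nonneg.2 (hz _)
  refine ⟨C, fun t ht => ?_⟩
  have ht' : (0 : ℝ) < t := by exact_mod_cast ht
  have hi : ∀ k, Integrable (fun ω => penObj f a b γ δ (sagaState (compGrad f a b γ δ) α x0
      (fun k => J k ω) k).1) P :=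
    fun k => integrable_sagaState hJ hm _ α x0 k fun s => penObj f a b γ δ s.1
  have h1 : ∫ ω, penObj f a b γ δ (avgIter f a b γ δ α x0 (fun k => J k ω) t) ∂P ≤
      (1 / (t : ℝ)) * ∑ k ∈ Finset.Icc 1 t, ∫ ω, penObj f a b γ δ
        (sagaState (compGrad f a b γ δ) α x0 (fun k => J k ω) k).1 ∂P := by
    rw [← integral_finsetSum _ fun k _ => hi k, ← integral_const_mul]
    exact integral_mono (integrable_avgIter hJ hm f a b γ δ α x0 t _)
      ((integrable_finsetSum _ fun k _ => hi k).const_mul _)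
      fun ω => (quadBounds_penObj hm ha hγ.le hδ hf).map_average_le ht _
  have h2 : ∑ k ∈ Finset.Icc 1 t, ∫ ω, (penObj f a b γ δ
      (sagaState (compGrad f a b γ δ) α x0 (fun k => J k ω) k).1 - penObj f a b γ δ z) ∂P ≤ C := by
    refine le_trans ?_ (hC (t + 1))
    refine Finset.sum_le_sum_of_subset_of_nonneg (fun k hk => ?_) fun k _ _ => hnn k
    rw [Finset.mem_Icc] at hk
    rw [Finset.mem_range]
    omega
  have h3 : ∀ k, ∫ ω, (penObj f a b γ δ
      (sagaState (compGrad f a b γ δ) α x0 (fun k => J k ω) k).1 - penObj f a b γ δ z) ∂P =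
      ∫ ω, penObj f a b γ δ
        (sagaState (compGrad f a b γ δ) α x0 (fun k => J k ω) k).1 ∂P - penObj f a b γ δ z := by
    intro k
    rw [integral_sub (hi k) (integrable_const _)]
    simp
  simp only [h3, Finset.sum_sub_distrib, Finset.sum_const, Nat.card_Icc, Nat.add_sub_cancel,
    nsmul_eq_mul] at h2
  rw [le_div_iff₀ ht']
  have h4 := mul_le_mul_of_nonneg_left h1 ht'.le
  rw [← mul_assoc, mul_one_div_cancel ht'.ne', one_mul] at h4
  linarith

/-- If all minimizers of `F ≥ f` have `f`-value at least `v`, then `f` falls below `v` by more than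
a given amount only at the expense of a proportional gap of `F`. -/
theorem exists_lower_bound_by_gap {f F : E n → ℝ} (hf : Continuous f) (hF : Continuous F)
    (hlev : ∀ r : ℝ, Bornology.IsBounded {x | f x ≤ r}) {z : E n} (hz : ∀ y, F z ≤ F y) {v : ℝ}
    (hv : ∀ x, (∀ y, F x ≤ F y) → v ≤ f x) {η : ℝ} (hη : 0 < η) :
    ∃ K : ℝ, 0 ≤ K ∧ ∀ x, v - η - K * (F x - F z) ≤ f x := by
  obtain ⟨w, hw⟩ := exists_forall_le_of_isBounded hf (fun _ => le_rfl) hlev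
  rcases Set.eq_empty_or_nonempty {x | f x ≤ v - η} with he | hne
  · refine ⟨0, le_rfl, fun x => ?_⟩
    have : x ∉ {x | f x ≤ v - η} := by simp [he]
    have h : v - η < f x := not_le.1 this
    linarith
  have hcomp : IsCompact {x | f x ≤ v - η} :=
    Metric.isCompact_of_isClosed_isBounded (isClosed_le hf continuous_const) (hlev _)
  obtain ⟨y, hy, hmin⟩ := hcomp.exists_isMinOn hne hF.continuousOn
  have hgap : 0 < F y - F z := by
    by_contra! h
    have h1 := hv y fun u => by linarith [hz u]
    have h2 : f y ≤ v - η := hy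
    linarith
  have hvw : 0 ≤ v - f w := by
    have h2 : f y ≤ v - η := hy
    linarith [hw y]
  refine ⟨(v - f w) / (F y - F z), by positivity, fun x => ?_⟩
  by_cases hx : f x ≤ v - η
  · have h1 : F y ≤ F x := hmin hx
    have h2 : v - f w ≤ (v - f w) / (F y - F z) * (F x - F z) := by
      rw [div_mul_eq_mul_div, le_div_iff₀ hgap]
      exact mul_le_mul_of_nonneg_left (by linarith) hvw
    linarith [hw x]
  · have h1 : 0 ≤ (v - f w) / (F y - F z) * (F x - F z) :=
      mul_nonneg (by positivity) (sub_nonneg.2 (hz x))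
    linarith

end Averages

end PenSAGA

open PenSAGA in
theorem theorem4p2 {n m : ℕ} (hm : 0 < m)
    (f : E n → ℝ) (a : Fin m → E n) (b : Fin m → ℝ) (ha : ∀ i, a i ≠ 0)
    (ε : ℝ) (hε : 0 < ε) (hint : ∃ x : E n, ∀ j, inner ℝ (a j) x - b j ≤ -ε)
    (β : ℝ) (hβ : IsHoffmanConst a β)
    (Lf : ℝ) (hLf : 0 < Lf) (hf : HasLipschitzGradient f Lf)
    (δ₀ : ℝ) (hδ₀ : 0 < δ₀) (γ δ : ℝ) (x0 : E n)
    {Ω : Type*} [MeasurableSpace Ω] (P : Measure Ω) [IsProbabilityMeasure P]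
    (J : ℕ → Ω → Fin m) (hJ : IsUniformSampling P J) :
    -- (a) strongly convex objective
    (∀ μf : ℝ, 0 < μf → StrongConvexOn Set.univ μf f →
      AdmissibleParams f a b β ε (2 * μf * alphaMin a * δ₀) γ δ →
      ∀ α q : ℝ, α = 1 / (2 * (μf * m + Lf + γ * alphaMax a / (2 * δ))) →
        q = 1 - μf / (2 * (μf * m + Lf + γ * alphaMax a / (2 * δ))) →
        (∃ C : ℝ, ∀ t : ℕ,
          ∫ ω, ‖iter f a b γ δ α x0 (fun k => J k ω) t -
              proj (feasible a b) (iter f a b γ δ α x0 (fun k => J k ω) t)‖ ^ 2 ∂P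
            ≤ C * q ^ t) ∧
        ∀ xs ∈ feasible a b, IsMinOn f (feasible a b) xs →
          ∃ C : ℝ, ∀ t : ℕ,
            ∫ ω, ‖iter f a b γ δ α x0 (fun k => J k ω) t - xs‖ ^ 2 ∂P
              ≤ C * q ^ t + 2 * δ₀) ∧
    -- (b) convex objective with bounded level sets
    (ConvexOn ℝ Set.univ f → (∀ r : ℝ, Bornology.IsBounded {x | f x ≤ r}) →
      AdmissibleParams f a b β ε (4 * alphaMin a * δ₀) γ δ →
      ∀ α : ℝ, α = 1 / (3 * (Lf + γ * alphaMax a / (2 * δ))) →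
        (∃ C : ℝ, ∀ t : ℕ, 1 ≤ t →
          ∫ ω, f (avgIter f a b γ δ α x0 (fun k => J k ω) t) ∂P - sInf (f '' feasible a b)
            ≤ C * (4 * m / t) + 2 * δ₀) ∧
        ∀ η : ℝ, 0 < η → ∃ T : ℕ, ∀ t : ℕ, T < t →
          -(γ * η) ≤
            ∫ ω, f (avgIter f a b γ δ α x0 (fun k => J k ω) t) ∂P -
              sInf (f '' feasible a b)) := by
  have hA := alphaMin_pos hm ha
  have hm' : (0 : ℝ) < m := by exact_mod_cast hm
  have hB : 0 < alphaMax a :=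
    (norm_pos_iff.2 (ha ⟨0, hm⟩)).trans_le (le_alphaMax a ⟨0, hm⟩)
  refine ⟨fun μ hμ hstrong hadm α q hα hq => ?_, fun hconv hlev hadm α hα => ?_⟩
  · have hQ := quadBounds_of_strongConvexOn hstrong hf
    have hQ0 := hQ.mono hμ.le le_rfl
    obtain ⟨z, hz⟩ := penSolutions_nonempty (b := b) hm ha hadm.1.le hadm.2.1 hQ0
      (hQ.isBounded_sublevel hμ)
    have hzX := mem_feasible_of_mem_penSolutions hm ha hint hβ hLf hf hQ0 hadm hz
    obtain ⟨hγ, hδ, -, hγκ, -⟩ := hadm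
    have hμL : μ ≤ Lf := by
      have h1 := hQ.monotone_slope (a ⟨0, hm⟩) 0
      have h2 := (real_inner_le_norm _ _).trans
        (mul_le_mul_of_nonneg_right (hf.2 (a ⟨0, hm⟩) 0) (norm_nonneg (a ⟨0, hm⟩ - 0)))
      have h3 : 0 < ‖a ⟨0, hm⟩ - 0‖ ^ 2 := by
        rw [sub_zero]
        exact pow_pos (norm_pos_iff.2 (ha _)) 2
      exact le_of_mul_le_mul_right (h1.trans (h2.trans (le_of_eq (by ring)))) h3
    have hpos : 0 < γ * alphaMax a / (2 * δ) := by positivity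
    have hα' : α = 1 / (2 * (μ * m + (Lf + γ * alphaMax a / (2 * δ)))) := by
      rw [hα, add_assoc]
    obtain ⟨C, hC⟩ := integral_norm_sq_sagaState_le hJ hm
      (quadBounds_compGrad (b := b) ha hγ.le hδ hQ) hμ (by linarith) hα'
      (sum_compGrad_eq_zero hm ha hLf hγ.le hδ hQ hz) x0
    have hq' : q = 1 - α * μ := by rw [hq, hα]; ring
    rw [← hq'] at hC
    have hi : ∀ (t : ℕ) (Ψ : E n → ℝ),
        Integrable (fun ω => Ψ (iter f a b γ δ α x0 (fun k => J k ω) t)) P := fun t Ψ =>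
      integrable_sagaState hJ hm (compGrad f a b γ δ) α x0 t fun s => Ψ s.1
    refine ⟨⟨C, fun t => le_trans ?_ (hC t)⟩, fun xs hxs hmin => ⟨2 * C, fun t => ?_⟩⟩
    · refine integral_mono (hi t fun y => ‖y - proj (feasible a b) y‖ ^ 2)
        (hi t fun y => ‖y - z‖ ^ 2) fun ω => ?_
      exact pow_le_pow_left₀ (norm_nonneg _) (norm_sub_proj_le (isClosed_feasible a b) hzX _) 2
    · have hzxs : ‖z - xs‖ ^ 2 ≤ δ₀ := by
        have h1 := (quadBounds_penObj (b := b) hm ha hγ.le hδ hQ).lower z xs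
        rw [sum_compGrad_eq_zero hm ha hLf hγ.le hδ hQ hz, smul_zero, inner_zero_left, add_zero,
          norm_sub_rev] at h1
        have h2 := penObj_le_of_mem_feasible (f := f) hm ha hγ.le hδ hxs
        have h3 := le_penObj (f := f) a b hγ.le hδ z
        have h4 : f xs ≤ f z := hmin hzX
        have h5 : γ * δ / (4 * alphaMin a) ≤ μ / 2 * δ₀ := by
          rw [div_le_iff₀ (by positivity)]
          have := (le_div_iff₀ hδ).1 hγκ
          linarith
        exact le_of_mul_le_mul_left (by linarith : μ / 2 * ‖z - xs‖ ^ 2 ≤ μ / 2 * δ₀)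
          (by positivity)
      calc ∫ ω, ‖iter f a b γ δ α x0 (fun k => J k ω) t - xs‖ ^ 2 ∂P
          ≤ ∫ ω, (2 * ‖iter f a b γ δ α x0 (fun k => J k ω) t - z‖ ^ 2 + 2 * δ₀) ∂P := by
            refine integral_mono (hi t fun y => ‖y - xs‖ ^ 2)
              (hi t fun y => 2 * ‖y - z‖ ^ 2 + 2 * δ₀) fun ω => ?_
            have h := norm_sub_sq_le_of_pos one_pos
              (iter f a b γ δ α x0 (fun k => J k ω) t - z) (xs - z)
            rw [sub_sub_sub_cancel_right, norm_sub_rev xs] at h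
            simp only
            linarith
        _ = 2 * ∫ ω, ‖iter f a b γ δ α x0 (fun k => J k ω) t - z‖ ^ 2 ∂P + 2 * δ₀ := by
            rw [integral_add ((hi t fun y => ‖y - z‖ ^ 2).const_mul 2) (integrable_const _),
              integral_const_mul]
            simp
        _ ≤ 2 * C * q ^ t + 2 * δ₀ := by
            have : ∫ ω, ‖iter f a b γ δ α x0 (fun k => J k ω) t - z‖ ^ 2 ∂P ≤ C * q ^ t := hC t
            linarith
  · have hQ := quadBounds_of_convexOn hconv hf
    obtain ⟨z, hz⟩ := penSolutions_nonempty (b := b) hm ha hadm.1.le hadm.2.1 hQ hlev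
    have hX : ∀ x ∈ penSolutions f a b γ δ, x ∈ feasible a b := fun x hx =>
      mem_feasible_of_mem_penSolutions hm ha hint hβ hLf hf hQ hadm hx
    obtain ⟨hγ, hδ, -, hγκ, -⟩ := hadm
    have hcont := hQ.continuous le_rfl
    have hcontF := (quadBounds_penObj (b := b) hm ha hγ.le hδ hQ).continuous le_rfl
    obtain ⟨w, hw⟩ := exists_forall_le_of_isBounded hcont (fun _ => le_rfl) hlev
    have hbdd : BddBelow (f '' feasible a b) := ⟨f w, by rintro _ ⟨x, -, rfl⟩; exact hw x⟩
    have hstar : penObj f a b γ δ z - δ₀ ≤ sInf (f '' feasible a b) := by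
      refine le_csInf ⟨f z, z, hX z hz, rfl⟩ ?_
      rintro _ ⟨x, hx, rfl⟩
      have h1 := penObj_le_of_mem_feasible (f := f) hm ha hγ.le hδ hx
      have h2 := hz x
      have h3 : γ * δ / (4 * alphaMin a) ≤ δ₀ := by
        rw [div_le_iff₀ (by positivity)]
        have := (le_div_iff₀ hδ).1 hγκ
        linarith
      linarith
    obtain ⟨C, hC⟩ := integral_penObj_avgIter_le hJ hm ha hLf hγ hδ hQ hα hz x0
    have hi := fun t => fun Ψ : E n → ℝ => integrable_avgIter hJ hm f a b γ δ α x0 t Ψ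
    refine ⟨⟨C / (4 * m), fun t ht => ?_⟩, fun η hη => ?_⟩
    · have h1 : ∫ ω, f (avgIter f a b γ δ α x0 (fun k => J k ω) t) ∂P ≤
          ∫ ω, penObj f a b γ δ (avgIter f a b γ δ α x0 (fun k => J k ω) t) ∂P :=
        integral_mono (hi t f) (hi t _) fun ω => le_penObj a b hγ.le hδ _
      have h2 := hC t ht
      have e : C / (4 * m) * (4 * m / t) = C / t := by field_simp
      rw [e]
      linarith
    · have hη2 : 0 < γ * η / 2 := by positivity
      obtain ⟨K, hK0, hK⟩ := exists_lower_bound_by_gap hcont hcontF hlev hz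
        (v := sInf (f '' feasible a b))
        (fun x hx => csInf_le hbdd ⟨x, hX x hx, rfl⟩) hη2
      obtain ⟨T, hT⟩ := exists_nat_gt (K * C / (γ * η / 2))
      refine ⟨T, fun t ht => ?_⟩
      have ht1 : 1 ≤ t := by omega
      have ht' : (0 : ℝ) < t := by exact_mod_cast ht1
      have hTt : K * C / (γ * η / 2) < t := hT.trans (by exact_mod_cast ht)
      have h1 : ∫ ω, (sInf (f '' feasible a b) - γ * η / 2 -
          K * (penObj f a b γ δ (avgIter f a b γ δ α x0 (fun k => J k ω) t) -
            penObj f a b γ δ z)) ∂P ≤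
          ∫ ω, f (avgIter f a b γ δ α x0 (fun k => J k ω) t) ∂P :=
        integral_mono (hi t fun y => sInf (f '' feasible a b) - γ * η / 2 -
          K * (penObj f a b γ δ y - penObj f a b γ δ z)) (hi t f) fun ω => hK _
      rw [integral_sub (integrable_const _) (hi t fun y =>
          K * (penObj f a b γ δ y - penObj f a b γ δ z)), integral_const_mul,
        integral_sub (hi t _) (integrable_const _)] at h1
      simp only [integral_const, probReal_univ, one_smul] at h1
      have h2 := mul_le_mul_of_nonneg_left (hC t ht1) hK0
      have h3 : K * (C / t) ≤ γ * η / 2 := by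
        rw [mul_div_assoc', div_le_iff₀ ht']
        rw [div_lt_iff₀ hη2] at hTt
        linarith
      linarith
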